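/- Let $a\in(0,1)$, $\boldsymbol\tau\in\mathbb{R}^2$, and let $\mathcal I=\mathbb{R}$ (with $\delta$ the Lebesgue measure and $a=e^{-\nu}$, $\nu>0$) or $\mathcal I=\mathbb{Z}$ (with $\delta$ the counting measure and $a=\phi\in(0,1)$). Put $g(t)=\nu e^{-\nu t}\mathbf 1_{\{t\ge 0\}}$ if $\mathcal I=\mathbb{R}$ and $g(t)=(1-\phi)\phi^t\mathbf 1_{\{t\ge 0\}}$ if $\mathcal I=\mathbb{Z}$. Let $(E_2,\mu_2,(V_{\mathbf x})_{\mathbf x\in\mathbb{R}^2})$ be of one of the following two kinds: (type 1) $E_2=\mathbb{R}^2$, $\mu_2$ is the Lebesgue measure and $V_{\mathbf x}(c)=f(\mathbf x-c)$ for a probability density $f$ on $\mathbb{R}^2$; (type 4) $E_2$ is the space of continuous functions from $\mathbb{R}^2$ to $(0,\infty)$, $V_{\mathbf x}(c)=c(\mathbf x)$, and $\mu_2$ is a probability measure on $E_2$ under which $(c(\mathbf x))_{\mathbf x}$ is strictly stationary with $\int c(\mathbf x)\,\mu_2(dc)=1$ for all $\mathbf x$. Let $(U_i,B_i,C_i)_{i\ge1}$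 be the points of a Poisson point process on $(0,\infty)\times\mathcal I\times E_2$ with intensity $u^{-2}du\times\delta(db)\times\mu_2(dc)$ and $$X(t,\mathbf x)=\bigvee_{i\ge 1} U_i\,g(t-B_i)\,V_{\mathbf x-(t-B_i)\boldsymbol\tau}(C_i),\qquad t\in\mathcal I,\ \mathbf x\in\mathbb{R}^2.$$ A random field $(Z(\mathbf x))_{\mathbf x\in\mathbb{R}^2}$ is said to have the spatial spectral law if it has the finite-dimensional distributions of $\bigvee_{i\ge1}U_iV_{\mathbf x}(C_i)$, where $(U_i,C_i)_{i\ge1}$ are the points of a Poisson point process on $(0,\infty)\times E_2$ with intensity $u^{-2}du\times\mu_2(dc)$. (i) For all $t,s\in\mathcal I$ with $s>0$ there is a random field $(Z(t,\mathbf x))_{\mathbf x\in\mathbb{R}^2}$ that has the spatial spectral law, is independent of $(X(t-s,\mathbf x))_{\mathbf x\in\mathbb{R}^2}$, and satisfies, for all $\mathbf x\in\mathbb{R}^2$, $$X(t,\mathbf x)=\max\bigl(a^sX(t-s,\mathbf x-s\boldsymbol\tau),\,(1-a^s)Z(t,\mathbf x)\bigr).$$ (ii) Let $\mathcal I=\mathbb{Z}$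 and let $(Z(t,\cdot))_{t\in\mathbb{Z}}$ be iid random fields with the spatial spectral law. Then $X$ has the same finite-dimensional distributions on $\mathbb{Z}\times\mathbb{R}^2$ as $$Y^*(t,\mathbf x)=\bigvee_{j\ge 0}a^j(1-a)\,Z(t-j,\mathbf x-j\boldsymbol\tau).$$ Moreover, $Y^*$ solves the spatial MARMA(1,0) equation $Y(t,\mathbf x)=\max(aY(t-1,\mathbf x-\boldsymbol\tau),(1-a)Z(t,\mathbf x))$ for all $(t,\mathbf x)\in\mathbb{Z}\times\mathbb{R}^2$, with $Z(t,\cdot)$ independent of $Y^*(t-1,\cdot)$ for each $t$; it is almost surely finite at each $(t,\mathbf x)$ and its one-dimensional marginal distribution is the same at all $(t,\mathbf x)$. It is the only such solution: any process $Y$ that satisfies the equation almost surely at each $(t,\mathbf x)$, is almost surely finite at each $(t,\mathbf x)$ and has the same one-dimensional marginal distribution at all $(t,\mathbf x)$ satisfies $Y(t,\mathbf x)=Y^*(t,\mathbf x)$ almost surely, for each $(t,\mathbf x)$. -/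

import Mathlib

open MeasureTheory ProbabilityTheory
open scoped ENNReal NNReal

namespace MaxStable

noncomputable section

/-- The spatial domain `ℝ²`. -/
abbrev Plane : Type := EuclideanSpace ℝ (Fin 2)

/-- The space of continuous functions from `ℝ²` to `(0,∞)`, with the σ-algebra generated by the
evaluation maps. -/
abbrev PosCont : Type := {c : Plane → ℝ // Continuous c ∧ ∀ x, 0 < c x}

/-! ### Poisson point processes -/

/-- The number (with multiplicity) of points of the random sequence `p` that lie in `A`. -/
def pointCount {Ω S : Type*} (p : ℕ → Ω → S) (A : Set S) (ω : Ω) : ℝ≥0∞ :=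
  ∑' i, A.indicator (fun _ => (1 : ℝ≥0∞)) (p i ω)

/-- The random sequence `p` lists the points of a Poisson point process with intensity measure `Λ`:
the number of points in a measurable set `A` has the Poisson distribution with mean `Λ A` (and is
almost surely infinite if `Λ A = ∞`), and the numbers of points in finitely many pairwise disjoint
measurable sets are independent. -/
structure IsPoissonPoints {Ω S : Type*} [MeasurableSpace Ω] [MeasurableSpace S]
    (p : ℕ → Ω → S) (Λ : Measure S) (P : Measure Ω) : Prop where
  measurable : ∀ i, Measurable (p i)
  count_law : ∀ A : Set S, MeasurableSet A → Λ A ≠ ∞ →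
    P.map (pointCount p A) =
      (poissonMeasure (Λ A).toNNReal).map (fun n : ℕ => (n : ℝ≥0∞))
  count_top : ∀ A : Set S, MeasurableSet A → Λ A = ∞ → ∀ᵐ ω ∂P, pointCount p A ω = ∞
  count_indep : ∀ (n : ℕ) (A : Fin n → Set S), (∀ j, MeasurableSet (A j)) →
    Pairwise (fun j k => Disjoint (A j) (A k)) → iIndepFun (fun j => pointCount p (A j)) P

/-- The measure `u⁻² du` on `(0,∞)`, seen as a measure on `ℝ` that does not charge `(-∞,0]`. -/
def heightMeasure : Measure ℝ :=
  (volume.restrict (Set.Ioi 0)).withDensity (fun u => ENNReal.ofReal ((u ^ 2)⁻¹))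

/-! ### Spectral representations -/

/-- The process `q ↦ ⋁ᵢ Uᵢ V_q(Wᵢ)`, with values in `[0,∞]`. -/
def spectralProcess {T Ω E : Type*} (V : T → E → ℝ) (U : ℕ → Ω → ℝ) (W : ℕ → Ω → E)
    (q : T) (ω : Ω) : ℝ≥0∞ :=
  ⨆ i, ENNReal.ofReal (U i ω * V q (W i ω))

/-- The spatial ingredients `(E₂, μ₂, (V_x)_x)` of a space-time max-stable model. -/
structure SpatialSpectrum where
  /-- the space of the spatial marks -/
  E : Type
  [mE : MeasurableSpace E]
  /-- the measure on the spatial marks -/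
  μ : Measure E
  /-- the spatial spectral functions -/
  V : Plane → E → ℝ

attribute [instance] SpatialSpectrum.mE

/-- Moving maxima driven by `f`: `E₂ = ℝ²`, `μ₂` is Lebesgue measure and `V_x(c) = f(x - c)`. -/
def movingMaxima (f : Plane → ℝ) : SpatialSpectrum where
  E := Plane
  μ := volume
  V := fun x c => f (x - c)

/-- Random spectral functions with law `μ`: `E₂ = C(ℝ², (0,∞))` and `V_x(c) = c(x)`. -/
def randomFunctions (μ : Measure PosCont) : SpatialSpectrum where
  E := PosCont
  μ := μ
  V := fun x c => c.1 x

/-- `f` is a probability density function on `ℝ²`. -/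
structure IsDensity (f : Plane → ℝ) : Prop where
  measurable : Measurable f
  nonneg : ∀ x, 0 ≤ f x
  lintegral_eq_one : ∫⁻ x, ENNReal.ofReal (f x) = 1

/-- `μ` is the law of a (strictly) stationary continuous positive random field on `ℝ²`, with mean
one at each site. -/
structure IsStationaryUnitMean (μ : Measure PosCont) : Prop where
  isProbabilityMeasure : IsProbabilityMeasure μ
  mean_eq_one : ∀ x : Plane, ∫⁻ c, ENNReal.ofReal (c.1 x) ∂μ = 1
  stationary : ∀ (h : Plane) (M : ℕ) (x : Fin M → Plane),
    IdentDistrib (fun (c : PosCont) (m : Fin M) => c.1 (x m + h))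
      (fun (c : PosCont) (m : Fin M) => c.1 (x m)) μ μ

/-- The spatial part of the models of type 1. -/
def SpatialSpectrum.IsType1 (S : SpatialSpectrum) : Prop :=
  ∃ f : Plane → ℝ, IsDensity f ∧ S = movingMaxima f

/-- The spatial part of the models of type 4. -/
def SpatialSpectrum.IsType4 (S : SpatialSpectrum) : Prop :=
  ∃ μ : Measure PosCont, IsStationaryUnitMean μ ∧ S = randomFunctions μ

/-- The space-time spectral functions `V_(t,x)(b,c) = g(t - b) V_{x - (t - b)τ}(c)`. -/
def SpatialSpectrum.spaceTime (S : SpatialSpectrum) {I : Type*} [Sub I] [SMul I Plane]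
    (g : I → ℝ) (τ : Plane) (q : I × Plane) (w : I × S.E) : ℝ :=
  g (q.1 - w.1) * S.V (q.2 - (q.1 - w.1) • τ) w.2

/-- The density of the exponential distribution with rate `ν`. -/
def expDensity (ν t : ℝ) : ℝ := if 0 ≤ t then ν * Real.exp (-ν * t) else 0

/-- The weights `(1 - φ) φ^t`, `t ≥ 0`, of the geometric distribution, as a function on `ℤ`. -/
def geomWeight (φ : ℝ) (t : ℤ) : ℝ := if 0 ≤ t then (1 - φ) * φ ^ t else 0

/-- The random field `Z` on `ℝ²` has the same finite-dimensional distributions as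
`⋁ᵢ Uᵢ V_x(Cᵢ)`, where the `(Uᵢ, Cᵢ)` are the points of a Poisson point process with
intensity `u⁻² du × μ₂(dc)`. -/
def SpatialSpectrum.HasSpectralLaw.{u} (S : SpatialSpectrum) {Ω : Type u} [MeasurableSpace Ω]
    (P : Measure Ω) (Z : Plane → Ω → ℝ≥0∞) : Prop :=
  ∃ (Ω' : Type u) (_ : MeasurableSpace Ω') (P' : Measure Ω') (_ : IsProbabilityMeasure P')
    (U : ℕ → Ω' → ℝ) (C : ℕ → Ω' → S.E),
    IsPoissonPoints (fun i ω => (U i ω, C i ω)) (heightMeasure.prod S.μ) P' ∧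
    ∀ (M : ℕ) (x : Fin M → Plane),
      IdentDistrib (fun ω m => Z (x m) ω) (fun ω m => spectralProcess S.V U C (x m) ω) P P'

/-! ### The max-autoregressive equation in discrete time -/

/-- The max-moving average `⋁_{j ≥ 0} a^j (1 - a) Z(t - j, x - jτ)`. -/
def maxMovingAverage {Ω : Type*} (a : ℝ) (τ : Plane) (Z : ℤ → Plane → Ω → ℝ≥0∞)
    (t : ℤ) (x : Plane) (ω : Ω) : ℝ≥0∞ :=
  ⨆ j : ℕ, ENNReal.ofReal (a ^ j * (1 - a)) * Z (t - (j : ℤ)) (x - j • τ) ω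

/-- `Y` solves the spatial MARMA(1,0) equation
`Y(t,x) = max (a Y(t-1, x-τ), (1-a) Z(t,x))`, is almost surely finite at each point of space-time,
and has the same one-dimensional marginal distribution at all points of space-time. -/
structure IsMARMASolution {Ω : Type*} [MeasurableSpace Ω] (P : Measure Ω) (a : ℝ) (τ : Plane)
    (Z Y : ℤ → Plane → Ω → ℝ≥0∞) : Prop where
  measurable : ∀ t x, Measurable (Y t x)
  recursion : ∀ t x, ∀ᵐ ω ∂P,
    Y t x ω = max (ENNReal.ofReal a * Y (t - 1) (x - τ) ω) (ENNReal.ofReal (1 - a) * Z t x ω)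
  finite : ∀ t x, ∀ᵐ ω ∂P, Y t x ω ≠ ∞
  marginals : ∀ t x t' x', IdentDistrib (Y t x) (Y t' x') P P

end

end MaxStable

universe u

/-! The proof rests on void probabilities. A field `x ↦ ⋁ᵢ ψ_x(pᵢ)` over Poisson points stays
below levels `y x` at finitely many sites exactly if no point falls into an exceedance set
(`supField_le_iff`), so its finite-dimensional distribution functions are `exp (-Λ(exceedance
set))` (`IsPoissonPoints.measure_supField_le`). As lower orthants form a π-system that generates
the product σ-algebra, two such fields whose exceedance sets have the same intensities have the
same law (`map_supField_eq`), and points in disjoint regions produce independent fields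
(`IsPoissonPoints.iIndepFun_supField`).

The measure `u⁻² du` is homogeneous of degree `-1`. With the stationarity of the spatial spectral
functions this gives that, for weights `w ≥ 0` with `∫ w = 1` and arbitrary shifts `h`, the field
`⋁ᵢ Uᵢ w(Bᵢ) V_{x - h(Bᵢ)}(Cᵢ)` has the spatial spectral law (`hasSpectralLaw_weighted`). The
Poisson points on `(0,∞) × E₂` that witness this are the `(Uᵢ v(Bᵢ), Cᵢ)` for a strictly positive
probability density `v`, so no new probability space is needed.

The innovation at lag `s` is the contribution to `X(t, ·)` of the points with `Bᵢ > t - s`,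
divided by `1 - a^s`; the points with `Bᵢ ≤ t - s` contribute `a^s X(t - s, · - sτ)`, as both
kernels satisfy `g(r + s) = a^s g(r)` (`exists_innovation`). In discrete time, grouping the points
by their time marks exhibits `X` as the max-moving average of its time slices, which are iid with
the spatial spectral law, so `X` has the law of the max-moving average of any such family
(`identDistrib_maxMovingAverage`). For uniqueness the recursion is iterated: a solution exceeds
the max-moving average at most by the remainder `aⁿ Y(t - n, x - nτ)`, which tends to zero in
probability because the marginals of `Y` are constant and finite
(`IsMARMASolution.ae_eq_maxMovingAverage`). -/

namespace MaxStable

/-! ### Laws on spaces of `[0,∞]`-valued fields -/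

/-- Finite-dimensional lower orthants `{f | f x ≤ y x for x ∈ F}` in a space of fields. -/
def orthants (T : Type*) : Set (Set (T → ℝ≥0∞)) :=
  squareCylinders fun _ => Set.range Set.Iic

lemma isPiSystem_orthants (T : Type*) : IsPiSystem (orthants T) :=
  isPiSystem_squareCylinders (fun _ => isPiSystem_Iic) (fun _ => ⟨⊤, Set.Iic_top⟩)

lemma exists_of_mem_orthants {T : Type*} {A : Set (T → ℝ≥0∞)} (hA : A ∈ orthants T) :
    ∃ (F : Finset T) (y : T → ℝ≥0∞), A = {f | ∀ x ∈ F, f x ≤ y x} := by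
  obtain ⟨F, t, ht, rfl⟩ := hA
  choose y hy using fun x => ht x (Set.mem_univ x)
  refine ⟨F, y, ?_⟩
  ext f
  simp [Set.mem_pi, ← hy]

lemma measurableSet_orthant {T : Type*} (F : Finset T) (y : T → ℝ≥0∞) :
    MeasurableSet {f : T → ℝ≥0∞ | ∀ x ∈ F, f x ≤ y x} := by
  have : {f : T → ℝ≥0∞ | ∀ x ∈ F, f x ≤ y x} = ⋂ x ∈ F, (fun f => f x) ⁻¹' Set.Iic (y x) := by
    ext; simp
  rw [this]
  exact Finset.measurableSet_biInter _ fun x _ => measurable_pi_apply x measurableSet_Iic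

lemma generateFrom_orthants (T : Type*) :
    MeasurableSpace.generateFrom (orthants T) = MeasurableSpace.pi := by
  apply le_antisymm
  · refine MeasurableSpace.generateFrom_le fun A hA => ?_
    obtain ⟨F, y, rfl⟩ := exists_of_mem_orthants hA
    exact measurableSet_orthant F y
  · refine iSup_le fun x => ?_
    rw [BorelSpace.measurable_eq (α := ℝ≥0∞), borel_eq_generateFrom_Iic,
      MeasurableSpace.comap_generateFrom]
    refine MeasurableSpace.generateFrom_mono ?_
    rintro _ ⟨_, ⟨r, rfl⟩, rfl⟩
    refine ⟨{x}, fun _ => Set.Iic r, fun _ _ => ⟨r, rfl⟩, ?_⟩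
    ext f
    simp

/-- A law of `[0,∞]`-valued fields is determined by its finite-dimensional distribution
functions. -/
lemma ext_of_orthants {T : Type*} {μ ν : Measure (T → ℝ≥0∞)} [IsProbabilityMeasure μ]
    [IsProbabilityMeasure ν]
    (h : ∀ (F : Finset T) (y : T → ℝ≥0∞),
      μ {f | ∀ x ∈ F, f x ≤ y x} = ν {f | ∀ x ∈ F, f x ≤ y x}) : μ = ν := by
  refine ext_of_generate_finite (orthants T) (generateFrom_orthants T).symm
    (isPiSystem_orthants T) ?_ (by simp)
  intro A hA
  obtain ⟨F, y, rfl⟩ := exists_of_mem_orthants hA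
  exact h F y

/-- Processes with the same finite-dimensional distributions have the same law as random
functions. -/
lemma map_eq_of_forall_identDistrib {T Ω Ω' R : Type*} [MeasurableSpace R] [MeasurableSpace Ω]
    [MeasurableSpace Ω'] {P : Measure Ω} {P' : Measure Ω'} [IsFiniteMeasure P]
    [IsFiniteMeasure P'] {X : T → Ω → R} {X' : T → Ω' → R} (hX : ∀ x, Measurable (X x))
    (hX' : ∀ x, Measurable (X' x))
    (h : ∀ (M : ℕ) (x : Fin M → T),
      IdentDistrib (fun ω m => X (x m) ω) (fun ω m => X' (x m) ω) P P') :
    P.map (fun ω x => X x ω) = P'.map (fun ω x => X' x ω) := by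
  have h1 := isProjectiveLimit_map (X := X) (P := P) (measurable_pi_lambda _ hX).aemeasurable
  have h2 := isProjectiveLimit_map (X := X') (P := P') (measurable_pi_lambda _ hX').aemeasurable
  refine h1.unique (ν := P'.map _) ?_
  convert h2 using 2 with F
  let e := F.equivFin
  have h3 := h F.card (fun m => (e.symm m : T))
  have h4 := (h3.comp (u := fun (v : Fin F.card → R) (x : F) => v (e x)) (by fun_prop)).map_eq
  simpa [Function.comp_def, Finset.restrict_def] using h4

/-! ### Suprema over the points of a Poisson process -/

/-- The field `x ↦ ⋁ᵢ ψ_x(pᵢ)` of suprema over a sequence of random points. -/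
noncomputable def supField {T Ω S : Type*} (ψ : T → S → ℝ) (p : ℕ → Ω → S) (x : T) (ω : Ω) :
    ℝ≥0∞ :=
  ⨆ i, ENNReal.ofReal (ψ x (p i ω))

/-- The points that push `⋁ᵢ ψ_x(pᵢ)` above the level `y x` at some site `x ∈ F`. -/
def exceedSet {T S : Type*} (ψ : T → S → ℝ) (F : Finset T) (y : T → ℝ≥0∞) : Set S :=
  {s | ∃ x ∈ F, y x < ENNReal.ofReal (ψ x s)}

lemma measurableSet_exceedSet {T S : Type*} [MeasurableSpace S] {ψ : T → S → ℝ}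
    (hψ : ∀ x, Measurable (ψ x)) (F : Finset T) (y : T → ℝ≥0∞) :
    MeasurableSet (exceedSet ψ F y) := by
  have : exceedSet ψ F y = ⋃ x ∈ F, {s | y x < ENNReal.ofReal (ψ x s)} := by
    ext; simp [exceedSet]
  rw [this]
  exact Finset.measurableSet_biUnion _ fun x _ =>
    measurableSet_lt measurable_const (hψ x).ennreal_ofReal

lemma pointCount_eq_zero_iff {Ω S : Type*} {p : ℕ → Ω → S} {A : Set S} {ω : Ω} :
    pointCount p A ω = 0 ↔ ∀ i, p i ω ∉ A := by
  simp [pointCount, ENNReal.tsum_eq_zero]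

lemma supField_le_iff {T Ω S : Type*} {ψ : T → S → ℝ} {p : ℕ → Ω → S} {F : Finset T}
    {y : T → ℝ≥0∞} {ω : Ω} :
    (∀ x ∈ F, supField ψ p x ω ≤ y x) ↔ pointCount p (exceedSet ψ F y) ω = 0 := by
  rw [pointCount_eq_zero_iff]
  simp only [supField, iSup_le_iff, exceedSet, Set.mem_ofPred_eq, not_exists, not_and, not_lt]
  exact ⟨fun h i x hx => h x hx i, fun h x hx i => h i x hx⟩

lemma measurable_supField {T Ω S : Type*} [MeasurableSpace Ω] [MeasurableSpace S] {ψ : T → S → ℝ}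
    {p : ℕ → Ω → S} (hψ : ∀ x, Measurable (ψ x)) (hp : ∀ i, Measurable (p i)) (x : T) :
    Measurable (supField ψ p x) :=
  Measurable.iSup fun i => ((hψ x).comp (hp i)).ennreal_ofReal

/-- The probability `exp (-r)` that a Poisson random variable with mean `r ∈ [0,∞]` vanishes. -/
noncomputable def voidProb (r : ℝ≥0∞) : ℝ≥0∞ :=
  if r = ∞ then 0 else ENNReal.ofReal (Real.exp (-r.toReal))

section Poisson

variable {Ω S : Type*} [MeasurableSpace Ω] [MeasurableSpace S] {p : ℕ → Ω → S} {Λ : Measure S}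
  {P : Measure Ω}

lemma measurable_pointCount (hp : ∀ i, Measurable (p i)) {A : Set S} (hA : MeasurableSet A) :
    Measurable (pointCount p A) :=
  Measurable.tsum fun i => (measurable_const.indicator hA).comp (hp i)

lemma IsPoissonPoints.measure_pointCount_eq_zero [IsProbabilityMeasure P]
    (h : IsPoissonPoints p Λ P) {A : Set S} (hA : MeasurableSet A) :
    P {ω | pointCount p A ω = 0} = voidProb (Λ A) := by
  by_cases hΛ : Λ A = ∞
  · have h0 : P {ω | pointCount p A ω = 0} = 0 := by
      refine measure_mono_null ?_ (ae_iff.1 (h.count_top A hA hΛ))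
      intro ω hω
      simp only [Set.mem_ofPred_eq] at hω ⊢
      simp [hω]
    rw [h0, voidProb, if_pos hΛ]
  · have h1 := h.count_law A hA hΛ
    have h2 : P {ω | pointCount p A ω = 0} = P.map (pointCount p A) {0} := by
      rw [Measure.map_apply (measurable_pointCount h.measurable hA) (measurableSet_singleton 0)]
      rfl
    have h3 : (fun n : ℕ => (n : ℝ≥0∞)) ⁻¹' {0} = {0} := by
      ext n; simp
    rw [h2, h1, Measure.map_apply .of_discrete (measurableSet_singleton 0), h3,
      poissonMeasure_singleton, voidProb, if_neg hΛ]
    simp [ENNReal.coe_toNNReal_eq_toReal]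

/-- The finite-dimensional distribution functions of a field of suprema over Poisson points are
void probabilities. -/
lemma IsPoissonPoints.measure_supField_le [IsProbabilityMeasure P] (h : IsPoissonPoints p Λ P)
    {T : Type*} {ψ : T → S → ℝ} (hψ : ∀ x, Measurable (ψ x)) (F : Finset T) (y : T → ℝ≥0∞) :
    P {ω | ∀ x ∈ F, supField ψ p x ω ≤ y x} = voidProb (Λ (exceedSet ψ F y)) := by
  rw [← h.measure_pointCount_eq_zero (measurableSet_exceedSet hψ F y)]
  congr 1
  ext ω
  exact supField_le_iff

/-- Fields of suprema over Poisson points whose exceedance sets have the same intensities have the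
same law. -/
lemma map_supField_eq [IsProbabilityMeasure P] {Ω' S' : Type*} [MeasurableSpace Ω']
    [MeasurableSpace S'] {p' : ℕ → Ω' → S'} {Λ' : Measure S'} {P' : Measure Ω'}
    [IsProbabilityMeasure P'] (h : IsPoissonPoints p Λ P) (h' : IsPoissonPoints p' Λ' P')
    {T : Type*} {ψ : T → S → ℝ} {ψ' : T → S' → ℝ} (hψ : ∀ x, Measurable (ψ x))
    (hψ' : ∀ x, Measurable (ψ' x))
    (hΛ : ∀ (F : Finset T) (y : T → ℝ≥0∞), Λ (exceedSet ψ F y) = Λ' (exceedSet ψ' F y)) :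
    P.map (fun ω x => supField ψ p x ω) = P'.map (fun ω x => supField ψ' p' x ω) := by
  have m1 : Measurable (fun ω x => supField ψ p x ω) :=
    measurable_pi_lambda _ (measurable_supField hψ h.measurable)
  have m2 : Measurable (fun ω x => supField ψ' p' x ω) :=
    measurable_pi_lambda _ (measurable_supField hψ' h'.measurable)
  have := Measure.isProbabilityMeasure_map (μ := P) m1.aemeasurable
  have := Measure.isProbabilityMeasure_map (μ := P') m2.aemeasurable
  refine ext_of_orthants fun F y => ?_
  rw [Measure.map_apply m1 (measurableSet_orthant F y),
    Measure.map_apply m2 (measurableSet_orthant F y)]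
  exact (h.measure_supField_le hψ F y).trans
    ((congrArg voidProb (hΛ F y)).trans (h'.measure_supField_le hψ' F y).symm)

/-- The points of a Poisson process in disjoint regions generate independent fields. -/
lemma IsPoissonPoints.iIndepFun_supField [IsProbabilityMeasure P] (h : IsPoissonPoints p Λ P)
    {K T : Type*} {ψ : K → T → S → ℝ} (hψ : ∀ k x, Measurable (ψ k x)) {D : K → Set S}
    (hD : Pairwise (Function.onFun Disjoint D)) (hψD : ∀ k x s, s ∉ D k → ψ k x s ≤ 0) :
    iIndepFun (fun k ω x => supField (ψ k) p x ω) P := by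
  have hmeas : ∀ k, Measurable (fun ω x => supField (ψ k) p x ω) := fun k =>
    measurable_pi_lambda _ (measurable_supField (hψ k) h.measurable)
  refine iIndepSets.iIndep (fun k => (hmeas k).comap_le)
    (fun k => Set.preimage (fun ω x => supField (ψ k) p x ω) '' orthants T)
    (fun k => (isPiSystem_orthants T).comap _) (fun k => ?_) ?_
  · rw [← MeasurableSpace.comap_generateFrom, generateFrom_orthants]
  rw [iIndepSets_iff]
  intro s f hf
  have key : ∀ k, ∃ A : Set S, MeasurableSet A ∧ A ⊆ D k ∧
      (k ∈ s → f k = pointCount p A ⁻¹' {0}) := by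
    intro k
    by_cases hk : k ∈ s
    · obtain ⟨B, hB, hBf⟩ := hf k hk
      obtain ⟨F, y, rfl⟩ := exists_of_mem_orthants hB
      refine ⟨exceedSet (ψ k) F y, measurableSet_exceedSet (hψ k) F y, ?_, fun _ => ?_⟩
      · rintro q ⟨x, -, hx⟩
        by_contra hq
        rw [ENNReal.ofReal_eq_zero.2 (hψD k x q hq)] at hx
        simp at hx
      · rw [← hBf]
        ext ω
        exact supField_le_iff
    · exact ⟨∅, .empty, Set.empty_subset _, fun h => absurd h hk⟩
  choose A hA hAD hAf using key
  let e := s.equivFin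
  have hind := h.count_indep s.card (fun j => A (e.symm j)) (fun j => hA _) (fun i j hij =>
    (hD (fun h => hij (e.symm.injective (Subtype.ext h)))).mono (hAD _) (hAD _))
  have h1 := hind.measure_inter_preimage_eq_mul Finset.univ (sets := fun _ => {0})
    (fun _ _ => measurableSet_singleton _)
  have h2 : (⋂ k ∈ s, f k) =
      ⋂ j ∈ (Finset.univ : Finset (Fin s.card)), pointCount p (A (e.symm j)) ⁻¹' {0} := by
    ext ω
    simp only [Set.mem_iInter, Finset.mem_univ, true_imp_iff]
    constructor
    · intro hω j
      rw [← hAf _ (e.symm j).2]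
      exact hω _ (e.symm j).2
    · intro hω k hk
      have := hω (e ⟨k, hk⟩)
      rw [e.symm_apply_apply] at this
      rwa [hAf k hk]
  rw [h2, h1, ← Finset.prod_attach s]
  refine Finset.prod_equiv e.symm (by simp) (fun j _ => ?_)
  rw [hAf _ (e.symm j).2]

lemma IsPoissonPoints.map (h : IsPoissonPoints p Λ P) {S' : Type*} [MeasurableSpace S']
    {φ : S → S'} (hφ : Measurable φ) :
    IsPoissonPoints (fun i ω => φ (p i ω)) (Λ.map φ) P where
  measurable i := hφ.comp (h.measurable i)
  count_law A hA hΛ := by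
    rw [Measure.map_apply hφ hA] at hΛ ⊢
    exact h.count_law _ (hφ hA) hΛ
  count_top A hA hΛ := by
    rw [Measure.map_apply hφ hA] at hΛ
    exact h.count_top _ (hφ hA) hΛ
  count_indep n A hA hd :=
    h.count_indep n (fun j => φ ⁻¹' A j) (fun j => hφ (hA j)) (fun _ _ hij => (hd hij).preimage φ)

end Poisson

/-! ### The height measure -/

instance : SigmaFinite heightMeasure := by
  unfold heightMeasure; infer_instance

/-- The measure `u⁻² du` is homogeneous of degree `-1`. -/
lemma heightMeasure_mul_preimage {k : ℝ} (hk : 0 < k) {B : Set ℝ} (hB : MeasurableSet B) :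
    heightMeasure {u | u * k ∈ B} = ENNReal.ofReal k * heightMeasure B := by
  have hB' : MeasurableSet {u : ℝ | u * k ∈ B} := (measurable_id.mul_const k) hB
  have hm : Measurable fun u : ℝ => ENNReal.ofReal ((u ^ 2)⁻¹) := by fun_prop
  let G : ℝ → ℝ≥0∞ := fun v =>
    (B ∩ Set.Ioi 0).indicator (fun v => ENNReal.ofReal k ^ 2 * ENNReal.ofReal ((v ^ 2)⁻¹)) v
  have hG : Measurable G := (hm.const_mul _).indicator (hB.inter measurableSet_Ioi)
  have h1 : heightMeasure {u | u * k ∈ B} = ∫⁻ u, G (k * u) := by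
    rw [heightMeasure, withDensity_apply _ hB', Measure.restrict_restrict hB',
      ← lintegral_indicator (hB'.inter measurableSet_Ioi)]
    refine lintegral_congr fun u => ?_
    by_cases hu : u * k ∈ B ∧ 0 < u
    · have h2 : u ∈ {u : ℝ | u * k ∈ B} ∩ Set.Ioi 0 := hu
      have h3 : k * u ∈ B ∩ Set.Ioi 0 := ⟨by simpa [mul_comm] using hu.1, mul_pos hk hu.2⟩
      simp only [G]
      rw [Set.indicator_of_mem h2, Set.indicator_of_mem h3, ← ENNReal.ofReal_pow hk.le,
        ← ENNReal.ofReal_mul (by positivity)]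
      congr 1
      field_simp
    · have h2 : u ∉ {u : ℝ | u * k ∈ B} ∩ Set.Ioi 0 := hu
      have h3 : k * u ∉ B ∩ Set.Ioi 0 := fun h =>
        hu ⟨by simpa [mul_comm] using h.1, (mul_pos_iff_of_pos_left hk).1 h.2⟩
      simp only [G]
      rw [Set.indicator_of_notMem h2, Set.indicator_of_notMem h3]
  have h2 : ∫⁻ u, G (k * u) = ENNReal.ofReal k⁻¹ * ∫⁻ v, G v := by
    rw [← lintegral_map hG (measurable_const_mul k), Real.map_volume_mul_left hk.ne',
      lintegral_smul_measure, abs_of_pos (inv_pos.2 hk), smul_eq_mul]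
  have h3 : ∫⁻ v, G v = ENNReal.ofReal k ^ 2 * heightMeasure B := by
    simp only [G]
    rw [lintegral_indicator (hB.inter measurableSet_Ioi), lintegral_const_mul _ hm, heightMeasure,
      withDensity_apply _ hB, Measure.restrict_restrict hB]
  rw [h1, h2, h3, ← mul_assoc, ← ENNReal.ofReal_pow hk.le, ← ENNReal.ofReal_mul (by positivity)]
  congr 2
  field_simp

lemma heightMeasure_Iic_zero : heightMeasure (Set.Iic 0) = 0 := by
  refine withDensity_absolutelyContinuous _ _ ?_
  rw [Measure.restrict_apply measurableSet_Iic, Set.Iic_inter_Ioi, Set.Ioc_self, measure_empty]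

lemma heightMeasure_Ioi_one : heightMeasure (Set.Ioi 1) = 1 := by
  have h0 : Set.Ioi (1 : ℝ) ∩ Set.Ioi 0 = Set.Ioi 1 :=
    Set.inter_eq_left.2 (Set.Ioi_subset_Ioi zero_le_one)
  have h1 : ∀ u ∈ Set.Ioi (1 : ℝ), (u ^ 2)⁻¹ = u ^ (-2 : ℝ) := fun u hu => by
    rw [Real.rpow_neg (zero_le_one.trans (le_of_lt hu)), Real.rpow_two]
  rw [heightMeasure, withDensity_apply _ measurableSet_Ioi,
    Measure.restrict_restrict measurableSet_Ioi, h0,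
    setLIntegral_congr_fun measurableSet_Ioi (fun u hu => by rw [h1 u hu]),
    ← ofReal_integral_eq_lintegral_ofReal (integrableOn_Ioi_rpow_of_lt (by norm_num) zero_lt_one)
      ((ae_restrict_iff' measurableSet_Ioi).2 (ae_of_all _ fun u hu =>
        Real.rpow_nonneg (zero_le_one.trans (le_of_lt hu)) _)),
    integral_Ioi_rpow_of_lt (by norm_num) zero_lt_one]
  norm_num

/-- Rescaling the heights by a weight `w(b)` multiplies intensities by `∫ w`. The condition at the
zeros of `w` is needed because the height `0` has no mass. -/
lemma measure_weighted_preimage {I E : Type*} [MeasurableSpace I] [MeasurableSpace E]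
    (δ : Measure I) (μ : Measure E) [SigmaFinite δ] [SigmaFinite μ] {w : I → ℝ}
    (hw : Measurable w) {A : Set (ℝ × I × E)} (hA : MeasurableSet A) {r : ℝ≥0∞}
    (hw0 : ∀ b, 0 < w b ∨ w b = 0 ∧ ∀ c, ((0 : ℝ), b, c) ∉ A)
    (hr : ∀ b, heightMeasure.prod μ {q | (q.1, b, q.2) ∈ A} = r) :
    heightMeasure.prod (δ.prod μ) {q | (q.1 * w q.2.1, q.2.1, q.2.2) ∈ A} =
      (∫⁻ b, ENNReal.ofReal (w b) ∂δ) * r := by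
  have hT : Measurable fun q : ℝ × I × E => (q.1 * w q.2.1, q.2.1, q.2.2) := by fun_prop
  have hslice : Measurable fun q : I × E => heightMeasure {u | (u, q) ∈ A} :=
    measurable_measure_prodMk_right hA
  have h1 : ∀ b c, heightMeasure {u | (u * w b, b, c) ∈ A} =
      ENNReal.ofReal (w b) * heightMeasure {u | (u, b, c) ∈ A} := by
    intro b c
    have hB : MeasurableSet {u : ℝ | (u, b, c) ∈ A} :=
      (measurable_id.prodMk measurable_const) hA
    rcases hw0 b with hb | ⟨hb, hb0⟩
    · exact heightMeasure_mul_preimage hb hB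
    · simp [hb, hb0 c]
  have h2 : ∀ b, ∫⁻ c, heightMeasure {u | (u, b, c) ∈ A} ∂μ = r := by
    intro b
    have hB : MeasurableSet {q : ℝ × E | (q.1, b, q.2) ∈ A} :=
      (show Measurable fun q : ℝ × E => (q.1, b, q.2) by fun_prop) hA
    rw [← hr b, Measure.prod_apply_symm hB]
    rfl
  have hm : Measurable fun q : I × E => ENNReal.ofReal (w q.1) * heightMeasure {u | (u, q) ∈ A} :=
    (hw.comp measurable_fst).ennreal_ofReal.mul hslice
  calc heightMeasure.prod (δ.prod μ) {q | (q.1 * w q.2.1, q.2.1, q.2.2) ∈ A}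
      = ∫⁻ q : I × E, heightMeasure {u | (u * w q.1, q.1, q.2) ∈ A} ∂(δ.prod μ) :=
        Measure.prod_apply_symm (hT hA)
    _ = ∫⁻ q : I × E, ENNReal.ofReal (w q.1) * heightMeasure {u | (u, q) ∈ A} ∂(δ.prod μ) :=
        lintegral_congr fun q => h1 q.1 q.2
    _ = ∫⁻ b, ∫⁻ c, ENNReal.ofReal (w b) * heightMeasure {u | (u, b, c) ∈ A} ∂μ ∂δ :=
        lintegral_prod _ hm.aemeasurable
    _ = ∫⁻ b, ENNReal.ofReal (w b) * r ∂δ := by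
        refine lintegral_congr fun b => ?_
        exact (lintegral_const_mul _ (hslice.comp (measurable_prodMk_left (x := b)))).trans
          (congrArg _ (h2 b))
    _ = _ := lintegral_mul_const _ hw.ennreal_ofReal

/-- A nonzero σ-finite measure has a positive probability density. -/
lemma exists_pos_density {I : Type*} [MeasurableSpace I] (δ : Measure I) [SigmaFinite δ]
    (hδ : δ ≠ 0) :
    ∃ w : I → ℝ, Measurable w ∧ (∀ b, 0 < w b) ∧ ∫⁻ b, ENNReal.ofReal (w b) ∂δ = 1 := by
  obtain ⟨g, hg0, hg, hg1⟩ := exists_pos_lintegral_lt_of_sigmaFinite δ (ε := 1) one_ne_zero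
  set m := ∫⁻ b, (g b : ℝ≥0∞) ∂δ with hm
  have hm0 : m ≠ 0 := by
    intro h0
    rw [hm, lintegral_eq_zero_iff (by fun_prop)] at h0
    refine hδ (ae_eq_bot.1 (Filter.empty_mem_iff_bot.1 ?_))
    filter_upwards [h0] with b hb
    simp only [Pi.zero_apply, ENNReal.coe_eq_zero] at hb
    exact (hg0 b).ne' hb
  have hmt : m ≠ ∞ := (hg1.trans ENNReal.one_lt_top).ne
  have hmr : 0 < m.toReal := ENNReal.toReal_pos hm0 hmt
  refine ⟨fun b => m.toReal⁻¹ * g b, by fun_prop, fun b => mul_pos (inv_pos.2 hmr) (hg0 b), ?_⟩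
  have : ∀ b, ENNReal.ofReal (m.toReal⁻¹ * g b) = m⁻¹ * g b := fun b => by
    rw [ENNReal.ofReal_mul (inv_nonneg.2 hmr.le), ENNReal.ofReal_inv_of_pos hmr,
      ENNReal.ofReal_toReal hmt, ENNReal.ofReal_coe_nnreal]
  simp_rw [this]
  rw [lintegral_const_mul _ (by fun_prop), ← hm, ENNReal.inv_mul_cancel hm0 hmt]

/-- Forgetting the time marks, after rescaling the heights by a positive probability density,
turns space-time Poisson points into spatial ones on the same probability space. -/
lemma IsPoissonPoints.exists_spatial {Ω I E : Type*} [MeasurableSpace Ω] [MeasurableSpace I]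
    [MeasurableSpace E] {P : Measure Ω} {δ : Measure I} {μ : Measure E} [SigmaFinite δ]
    [SigmaFinite μ] (hδ : δ ≠ 0) {p : ℕ → Ω → ℝ × I × E}
    (h : IsPoissonPoints p (heightMeasure.prod (δ.prod μ)) P) :
    ∃ (U : ℕ → Ω → ℝ) (C : ℕ → Ω → E),
      IsPoissonPoints (fun i ω => (U i ω, C i ω)) (heightMeasure.prod μ) P := by
  obtain ⟨w, hw, hw0, hw1⟩ := exists_pos_density δ hδ
  have hφ : Measurable fun q : ℝ × I × E => (q.1 * w q.2.1, q.2.2) := by fun_prop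
  refine ⟨fun i ω => (p i ω).1 * w (p i ω).2.1, fun i ω => (p i ω).2.2, ?_⟩
  convert h.map hφ using 1
  ext A hA
  rw [Measure.map_apply hφ hA]
  have hA' : MeasurableSet {q : ℝ × I × E | (q.1, q.2.2) ∈ A} :=
    (show Measurable fun q : ℝ × I × E => (q.1, q.2.2) by fun_prop) hA
  have := measure_weighted_preimage δ μ hw hA' (fun b => Or.inl (hw0 b))
    (r := heightMeasure.prod μ A) (fun b => rfl)
  rw [hw1, one_mul] at this
  exact this.symm

/-! ### Spatial spectra -/

/-- The properties of the spatial parts of types 1 and 4 on which the theory rests. -/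
structure SpatialSpectrum.IsRegular (S : SpatialSpectrum) : Prop where
  sigmaFinite : SigmaFinite S.μ
  measurable : Measurable fun q : Plane × S.E => S.V q.1 q.2
  mean_eq_one : ∀ x, ∫⁻ c, ENNReal.ofReal (S.V x c) ∂S.μ = 1
  stationary : ∀ h : Plane, S.μ.map (fun c x => S.V (x + h) c) = S.μ.map (fun c x => S.V x c)

lemma SpatialSpectrum.IsType1.isRegular {S : SpatialSpectrum} (hS : S.IsType1) : S.IsRegular := by
  obtain ⟨f, hf, rfl⟩ := hS
  refine ⟨inferInstanceAs (SigmaFinite (volume : Measure Plane)), ?_, fun x => ?_, fun h => ?_⟩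
  · exact hf.measurable.comp (measurable_fst.sub measurable_snd)
  · rw [← hf.lintegral_eq_one]
    exact lintegral_sub_left_eq_self (μ := (volume : Measure Plane))
      (fun c => ENNReal.ofReal (f c)) x
  · have hm : Measurable fun (c : Plane) (x : Plane) => f (x - c) :=
      measurable_pi_lambda _ fun x => hf.measurable.comp (measurable_const.sub measurable_id)
    have h1 : (fun (c : Plane) (x : Plane) => f (x + h - c)) =
        (fun (c : Plane) (x : Plane) => f (x - c)) ∘ fun c => c - h := by
      ext c x
      simp only [Function.comp]
      congr 1
      abel
    change (volume : Measure Plane).map (fun c x => f (x + h - c)) =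
      (volume : Measure Plane).map (fun c x => f (x - c))
    rw [h1, ← Measure.map_map hm (measurable_sub_const h),
      (measurePreserving_sub_right volume h).map_eq]

lemma SpatialSpectrum.IsType4.isRegular {S : SpatialSpectrum} (hS : S.IsType4) : S.IsRegular := by
  obtain ⟨μ, hμ, rfl⟩ := hS
  have := hμ.isProbabilityMeasure
  have hm : ∀ x : Plane, Measurable fun c : PosCont => c.1 x := fun x =>
    (measurable_pi_apply x).comp measurable_subtype_coe
  refine ⟨inferInstanceAs (SigmaFinite μ), ?_, hμ.mean_eq_one, fun h => ?_⟩
  · exact measurable_uncurry_of_continuous_of_measurable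
      (u := fun (x : Plane) (c : PosCont) => c.1 x) (fun c => c.2.1) hm
  · exact map_eq_of_forall_identDistrib (P := μ) (P' := μ)
      (X := fun (x : Plane) (c : PosCont) => c.1 (x + h))
      (X' := fun (x : Plane) (c : PosCont) => c.1 x) (fun x => hm _) hm
      (fun M x => hμ.stationary h M x)

/-- The intensity of the exceedances of given levels is invariant under spatial shifts. -/
lemma SpatialSpectrum.IsRegular.measure_exceedSet_shift {S : SpatialSpectrum} (hS : S.IsRegular)
    (h : Plane) (F : Finset Plane) (y : Plane → ℝ≥0∞) :
    heightMeasure.prod S.μ (exceedSet (fun x q => q.1 * S.V (x + h) q.2) F y) =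
      heightMeasure.prod S.μ (exceedSet (fun x q => q.1 * S.V x q.2) F y) := by
  have := hS.sigmaFinite
  have hV : ∀ x, Measurable (S.V x) := fun x => hS.measurable.comp measurable_prodMk_left
  have hA : MeasurableSet
      (exceedSet (fun (x : Plane) (q : ℝ × (Plane → ℝ)) => q.1 * q.2 x) F y) :=
    measurableSet_exceedSet (fun x => by fun_prop) F y
  have hG := measurable_measure_prodMk_right (μ := heightMeasure) hA
  have key : ∀ k : Plane,
      heightMeasure.prod S.μ (exceedSet (fun x q => q.1 * S.V (x + k) q.2) F y) =
        ∫⁻ v, heightMeasure ((fun u => (u, v)) ⁻¹'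
          exceedSet (fun (x : Plane) (q : ℝ × (Plane → ℝ)) => q.1 * q.2 x) F y)
          ∂(S.μ.map fun c x => S.V (x + k) c) := by
    intro k
    have hE : MeasurableSet (exceedSet (fun x (q : ℝ × S.E) => q.1 * S.V (x + k) q.2) F y) :=
      measurableSet_exceedSet (fun x => measurable_fst.mul ((hV _).comp measurable_snd)) F y
    rw [Measure.prod_apply_symm hE,
      lintegral_map hG (measurable_pi_lambda _ fun x => hV _)]
    rfl
  have h0 := key 0
  simp only [add_zero] at h0
  rw [key h, h0, hS.stationary h]

/-! ### Fields with the spatial spectral law -/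

lemma SpatialSpectrum.IsRegular.measurable_V {S : SpatialSpectrum} (hS : S.IsRegular) (x : Plane) :
    Measurable (S.V x) :=
  hS.measurable.comp measurable_prodMk_left

/-- The law of a field with the spatial spectral law is that of the suprema over any Poisson
points with intensity `u⁻² du × μ₂(dc)`. -/
lemma SpatialSpectrum.HasSpectralLaw.map_eq_supField {S : SpatialSpectrum} (hS : S.IsRegular)
    {Ω : Type u} [MeasurableSpace Ω] {P : Measure Ω} [IsProbabilityMeasure P]
    {Z : Plane → Ω → ℝ≥0∞} (hZ : ∀ x, Measurable (Z x)) (h : S.HasSpectralLaw P Z)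
    {Ω' : Type*} [MeasurableSpace Ω'] {P' : Measure Ω'} [IsProbabilityMeasure P']
    {p : ℕ → Ω' → ℝ × S.E} (hp : IsPoissonPoints p (heightMeasure.prod S.μ) P') :
    P.map (fun ω x => Z x ω) = P'.map (fun ω x => supField (fun x q => q.1 * S.V x q.2) p x ω) := by
  obtain ⟨Ω₁, _, P₁, _, U, C, hUC, hlaw⟩ := h
  have hψ : ∀ x, Measurable fun q : ℝ × S.E => q.1 * S.V x q.2 := fun x =>
    measurable_fst.mul ((hS.measurable_V x).comp measurable_snd)
  rw [← map_supField_eq hUC hp hψ hψ fun _ _ => rfl]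
  exact map_eq_of_forall_identDistrib hZ (measurable_supField hψ hUC.measurable) hlaw

lemma SpatialSpectrum.HasSpectralLaw.map_eq {S : SpatialSpectrum} (hS : S.IsRegular)
    {Ω Ω' : Type u} [MeasurableSpace Ω] {P : Measure Ω} [IsProbabilityMeasure P]
    [MeasurableSpace Ω'] {P' : Measure Ω'} [IsProbabilityMeasure P']
    {Z : Plane → Ω → ℝ≥0∞} {Z' : Plane → Ω' → ℝ≥0∞} (hZ : ∀ x, Measurable (Z x))
    (hZ' : ∀ x, Measurable (Z' x)) (h : S.HasSpectralLaw P Z) (h' : S.HasSpectralLaw P' Z') :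
    P.map (fun ω x => Z x ω) = P'.map (fun ω x => Z' x ω) := by
  obtain ⟨Ω₁, _, P₁, _, U, C, hUC, -⟩ := id h
  rw [h.map_eq_supField hS hZ hUC, h'.map_eq_supField hS hZ' hUC]

section Weighted

variable {S : SpatialSpectrum} {I : Type*}

/-- Spectral functions `w(b) V_{x - h(b)}(c)` of a point `(u, b, c)`, multiplied by its height
`u`. -/
def weighted (S : SpatialSpectrum) (w : I → ℝ) (h : I → Plane) (x : Plane) (q : ℝ × I × S.E) : ℝ :=
  q.1 * (w q.2.1 * S.V (x - h q.2.1) q.2.2)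

variable [MeasurableSpace I] {w : I → ℝ} {h : I → Plane}

lemma measurable_weighted (hS : S.IsRegular) (hw : Measurable w) (hh : Measurable h) (x : Plane) :
    Measurable (weighted S w h x) := by
  have h1 : Measurable fun q : ℝ × I × S.E => S.V (x - h q.2.1) q.2.2 :=
    hS.measurable.comp (show Measurable fun q : ℝ × I × S.E => (x - h q.2.1, q.2.2) by fun_prop)
  exact measurable_fst.mul ((hw.comp (by fun_prop)).mul h1)

lemma measure_exceedSet_weighted (hS : S.IsRegular) (δ : Measure I) [SigmaFinite δ]
    (hw : Measurable w) (hw0 : ∀ b, 0 ≤ w b) (hh : Measurable h) (F : Finset Plane)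
    (y : Plane → ℝ≥0∞) :
    heightMeasure.prod (δ.prod S.μ) (exceedSet (weighted S w h) F y) =
      (∫⁻ b, ENNReal.ofReal (w b) ∂δ) *
        heightMeasure.prod S.μ (exceedSet (fun x q => q.1 * S.V x q.2) F y) := by
  have := hS.sigmaFinite
  have hA : MeasurableSet (exceedSet (weighted S (fun _ => 1) h) F y) :=
    measurableSet_exceedSet (measurable_weighted hS measurable_const hh) F y
  rw [← measure_weighted_preimage δ S.μ hw hA (fun b => ?_) (fun b => ?_)]
  · congr 1
    ext q
    simp [exceedSet, weighted, mul_assoc]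
  · rcases (hw0 b).lt_or_eq with hb | hb
    · exact Or.inl hb
    · exact Or.inr ⟨hb.symm, fun c => by simp [exceedSet, weighted]⟩
  · rw [← hS.measure_exceedSet_shift (-h b) F y]
    congr 1
    ext q
    simp [exceedSet, weighted, sub_eq_add_neg]

/-- If the weights integrate to one, then the suprema of the weighted and shifted spectral functions
have the spatial spectral law. -/
lemma hasSpectralLaw_weighted (hS : S.IsRegular) {δ : Measure I} [SigmaFinite δ]
    (hw : Measurable w) (hw0 : ∀ b, 0 ≤ w b) (hw1 : ∫⁻ b, ENNReal.ofReal (w b) ∂δ = 1)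
    (hh : Measurable h) {Ω : Type u} [MeasurableSpace Ω] {P : Measure Ω} [IsProbabilityMeasure P]
    {p : ℕ → Ω → ℝ × I × S.E} (hp : IsPoissonPoints p (heightMeasure.prod (δ.prod S.μ)) P) :
    S.HasSpectralLaw P (supField (weighted S w h) p) := by
  have := hS.sigmaFinite
  have hδ : δ ≠ 0 := by
    rintro rfl
    simp at hw1
  obtain ⟨U, C, hUC⟩ := hp.exists_spatial hδ
  have hψ : ∀ x, Measurable fun q : ℝ × S.E => q.1 * S.V x q.2 := fun x =>
    measurable_fst.mul ((hS.measurable_V x).comp measurable_snd)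
  have hψ' := measurable_weighted hS hw hh
  refine ⟨Ω, _, P, inferInstance, U, C, hUC, fun M x => ?_⟩
  have hlaw := map_supField_eq hp hUC hψ' hψ fun F y => by
    rw [measure_exceedSet_weighted hS δ hw hw0 hh, hw1, one_mul]
  have hid : IdentDistrib (fun ω x => supField (weighted S w h) p x ω)
      (fun ω x => supField (fun x q => q.1 * S.V x q.2) (fun i ω => (U i ω, C i ω)) x ω) P P :=
    ⟨(measurable_pi_lambda _ (measurable_supField hψ' hp.measurable)).aemeasurable,
      (measurable_pi_lambda _ (measurable_supField hψ hUC.measurable)).aemeasurable, hlaw⟩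
  exact hid.comp (u := fun (f : Plane → ℝ≥0∞) m => f (x m)) (by fun_prop)

/-- The spatial spectral law has finite marginals: as the spectral functions have mean one, the
exceedances of `n` at a site have intensity at most `1 / n`. -/
lemma ae_ne_top_of_isPoissonPoints (hS : S.IsRegular) {Ω : Type*} [MeasurableSpace Ω]
    {P : Measure Ω} [IsProbabilityMeasure P] {p : ℕ → Ω → ℝ × S.E}
    (hp : IsPoissonPoints p (heightMeasure.prod S.μ) P) (x : Plane) :
    ∀ᵐ ω ∂P, supField (fun x q => q.1 * S.V x q.2) p x ω ≠ ∞ := by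
  have := hS.sigmaFinite
  have hψ : ∀ x, Measurable fun q : ℝ × S.E => q.1 * S.V x q.2 := fun x =>
    measurable_fst.mul ((hS.measurable_V x).comp measurable_snd)
  set Z := supField (fun x q => q.1 * S.V x q.2) p
  have hZm : Measurable (Z x) := measurable_supField hψ hp.measurable x
  have hint : ∀ n : ℕ, heightMeasure.prod S.μ
      (exceedSet (fun x q => q.1 * S.V x q.2) {x} fun _ => ((n + 1 : ℕ) : ℝ≥0∞)) ≤
        ENNReal.ofReal ((n + 1 : ℝ)⁻¹) := by
    intro n
    have hn : (0 : ℝ) < n + 1 := by positivity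
    rw [Measure.prod_apply_symm (measurableSet_exceedSet hψ _ _)]
    calc ∫⁻ c, heightMeasure ((fun u => (u, c)) ⁻¹'
          exceedSet (fun x q => q.1 * S.V x q.2) {x} fun _ => ((n + 1 : ℕ) : ℝ≥0∞)) ∂S.μ
        ≤ ∫⁻ c, ENNReal.ofReal ((n + 1 : ℝ)⁻¹) * ENNReal.ofReal (S.V x c) ∂S.μ := by
          refine lintegral_mono fun c => ?_
          have h1 : ((fun u => (u, c)) ⁻¹'
              exceedSet (fun x q => q.1 * S.V x q.2) {x} fun _ => ((n + 1 : ℕ) : ℝ≥0∞)) =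
              {u : ℝ | (n + 1 : ℝ) < u * S.V x c} := by
            ext u
            simp only [exceedSet, Finset.mem_singleton, exists_eq_left, Set.mem_preimage,
              Set.mem_ofPred_eq]
            rw [← ENNReal.ofReal_natCast, ENNReal.ofReal_lt_ofReal_iff_of_nonneg (by positivity)]
            push_cast
            rfl
          rw [h1]
          rcases le_or_gt (S.V x c) 0 with hv | hv
          · refine le_of_eq_of_le ?_ zero_le
            refine measure_mono_null (fun u hu => ?_) heightMeasure_Iic_zero
            simp only [Set.mem_ofPred_eq] at hu
            by_contra! h2
            rw [Set.mem_Iic, not_le] at h2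
            linarith [mul_nonpos_of_nonneg_of_nonpos h2.le hv]
          · have h2 : {u : ℝ | (n + 1 : ℝ) < u * S.V x c} =
                {u | u * ((n + 1 : ℝ)⁻¹ * S.V x c) ∈ Set.Ioi 1} := by
              ext u
              simp only [Set.mem_ofPred_eq, Set.mem_Ioi]
              rw [show u * ((n + 1 : ℝ)⁻¹ * S.V x c) = u * S.V x c / (n + 1) by
                field_simp, one_lt_div hn]
            rw [h2, heightMeasure_mul_preimage (by positivity) measurableSet_Ioi,
              heightMeasure_Ioi_one, mul_one, ENNReal.ofReal_mul (by positivity)]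
      _ = ENNReal.ofReal ((n + 1 : ℝ)⁻¹) := by
          rw [lintegral_const_mul _ (hS.measurable_V x).ennreal_ofReal, hS.mean_eq_one, mul_one]
  have hlow : ∀ n : ℕ, ENNReal.ofReal (Real.exp (-(n + 1 : ℝ)⁻¹)) ≤ P {ω | Z x ω ≠ ∞} := by
    intro n
    have h1 := hp.measure_supField_le hψ {x} fun _ => ((n + 1 : ℕ) : ℝ≥0∞)
    have h2 := hint n
    have h3 := ne_top_of_le_ne_top ENNReal.ofReal_ne_top h2
    calc ENNReal.ofReal (Real.exp (-(n + 1 : ℝ)⁻¹))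
        ≤ voidProb (heightMeasure.prod S.μ
            (exceedSet (fun x q => q.1 * S.V x q.2) {x} fun _ => ((n + 1 : ℕ) : ℝ≥0∞))) := by
          rw [voidProb, if_neg h3]
          refine ENNReal.ofReal_le_ofReal (Real.exp_le_exp.2 (neg_le_neg ?_))
          exact ENNReal.toReal_le_of_le_ofReal (by positivity) h2
      _ ≤ P {ω | Z x ω ≠ ∞} := by
          rw [← h1]
          refine measure_mono fun ω hω => ?_
          have := hω x (Finset.mem_singleton_self x)
          exact ne_top_of_le_ne_top (ENNReal.natCast_ne_top _) this
  have hlim : Filter.Tendsto (fun n : ℕ => ENNReal.ofReal (Real.exp (-(n + 1 : ℝ)⁻¹))) Filter.atTop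
      (nhds 1) := by
    rw [← ENNReal.ofReal_one]
    refine ENNReal.tendsto_ofReal ?_
    have h1 : Filter.Tendsto (fun n : ℕ => -(n + 1 : ℝ)⁻¹) Filter.atTop (nhds (-0)) := by
      simpa using (tendsto_one_div_add_atTop_nhds_zero_nat (𝕜 := ℝ)).neg
    simpa [Function.comp_def] using (Real.continuous_exp.tendsto _).comp h1
  have h1 : P {ω | Z x ω ≠ ∞} = 1 := le_antisymm prob_le_one (le_of_tendsto' hlim hlow)
  exact (prob_compl_eq_zero_iff (measurableSet_eq_fun hZm measurable_const).compl).2 h1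

lemma SpatialSpectrum.HasSpectralLaw.ae_ne_top (hS : S.IsRegular) {Ω : Type u}
    [MeasurableSpace Ω] {P : Measure Ω} [IsProbabilityMeasure P] {Z : Plane → Ω → ℝ≥0∞}
    (hZ : ∀ x, Measurable (Z x)) (hlaw : S.HasSpectralLaw P Z) (x : Plane) :
    ∀ᵐ ω ∂P, Z x ω ≠ ∞ := by
  obtain ⟨Ω₁, _, P₁, _, U, C, hUC, -⟩ := id hlaw
  have hψ : ∀ x, Measurable fun q : ℝ × S.E => q.1 * S.V x q.2 := fun x =>
    measurable_fst.mul ((hS.measurable_V x).comp measurable_snd)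
  have h1 := ae_ne_top_of_isPoissonPoints hS hUC x
  have hs : MeasurableSet {f : Plane → ℝ≥0∞ | f x ≠ ∞} :=
    (measurableSet_eq_fun (measurable_pi_apply x) measurable_const).compl
  rw [← ae_map_iff (p := fun f : Plane → ℝ≥0∞ => f x ≠ ∞)
    (measurable_pi_lambda _ (measurable_supField hψ hUC.measurable)).aemeasurable hs,
    ← hlaw.map_eq_supField hS hZ hUC] at h1
  exact (ae_map_iff (measurable_pi_lambda _ hZ).aemeasurable hs).1 h1

end Weighted

/-! ### Innovations of space-time processes -/

/-- The mass that a kernel `g` with total mass one and `g(r + s) = α g(r)` gives to the times at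
most `s` back is `1 - α`, as it gives mass `α` to the earlier ones. -/
lemma setLIntegral_kernel_Ioi {I : Type*} [AddCommGroup I] [LinearOrder I] [IsOrderedAddMonoid I]
    [TopologicalSpace I] [OrderClosedTopology I] [MeasurableSpace I] [OpensMeasurableSpace I]
    [MeasurableSub I] {δ : Measure I} {g : I → ℝ} (hg : Measurable g)
    (hgneg : ∀ r, r < 0 → g r = 0) {α : ℝ} (hα0 : 0 ≤ α) {s t : I}
    (hshift : ∀ r, 0 ≤ r → g (r + s) = α * g r)
    (hint : ∀ t, ∫⁻ b, ENNReal.ofReal (g (t - b)) ∂δ = 1) :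
    ∫⁻ b in Set.Ioi (t - s), ENNReal.ofReal (g (t - b)) ∂δ = ENNReal.ofReal (1 - α) := by
  have hgt : ∀ t : I, Measurable fun b => g (t - b) := fun t => hg.comp (measurable_const_sub t)
  have h1 : ∫⁻ b in Set.Iic (t - s), ENNReal.ofReal (g (t - b)) ∂δ = ENNReal.ofReal α := by
    rw [← mul_one (ENNReal.ofReal α), ← hint (t - s),
      ← lintegral_const_mul _ (hgt _).ennreal_ofReal, ← lintegral_indicator measurableSet_Iic]
    refine lintegral_congr fun b => ?_
    rcases le_or_gt b (t - s) with hb | hb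
    · rw [Set.indicator_of_mem (Set.mem_Iic.2 hb), ← ENNReal.ofReal_mul hα0,
        ← hshift _ (sub_nonneg.2 hb)]
      congr 2
      abel
    · rw [Set.indicator_of_notMem (by simpa using hb), hgneg _ (sub_neg.2 hb)]
      simp
  have h2 := lintegral_add_compl (μ := δ) (fun b => ENNReal.ofReal (g (t - b)))
    (measurableSet_Iic (a := t - s))
  rw [h1, hint, Set.compl_Iic] at h2
  rw [ENNReal.ofReal_sub _ hα0, ENNReal.ofReal_one, ← h2,
    ENNReal.add_sub_cancel_left ENNReal.ofReal_ne_top]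

/-- A space-time process driven by a kernel `g` that vanishes on negative times and satisfies
`g(r + s) = α g(r)` for `r ≥ 0` is a max-autoregression: the points with `b ≤ t - s` contribute the
transported past, those with `b > t - s` an independent innovation. -/
lemma exists_innovation {S : SpatialSpectrum} (hS : S.IsRegular) {τ : Plane} {I : Type*}
    [Ring I] [LinearOrder I] [IsStrictOrderedRing I] [Module I Plane] [TopologicalSpace I]
    [OrderClosedTopology I] [MeasurableSpace I] [OpensMeasurableSpace I] [MeasurableSub I]
    {δ : Measure I} [SigmaFinite δ] (hτ : Measurable fun r : I => r • τ) {g : I → ℝ}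
    (hg : Measurable g) (hg0 : ∀ r, 0 ≤ g r) (hgneg : ∀ r, r < 0 → g r = 0) {α : ℝ} (hα0 : 0 < α)
    (hα1 : α < 1) {s t : I} (hshift : ∀ r, 0 ≤ r → g (r + s) = α * g r)
    (hint : ∀ t, ∫⁻ b, ENNReal.ofReal (g (t - b)) ∂δ = 1)
    {Ω : Type u} [MeasurableSpace Ω] {P : Measure Ω} [IsProbabilityMeasure P]
    {U : ℕ → Ω → ℝ} {B : ℕ → Ω → I} {C : ℕ → Ω → S.E}
    (hp : IsPoissonPoints (fun i ω => (U i ω, B i ω, C i ω)) (heightMeasure.prod (δ.prod S.μ)) P)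
    {X : I → Plane → Ω → ℝ≥0∞}
    (hX : ∀ t x ω, X t x ω =
      spectralProcess (S.spaceTime g τ) U (fun i ω => (B i ω, C i ω)) (t, x) ω) :
    ∃ Z : Plane → Ω → ℝ≥0∞, (∀ x, Measurable (Z x)) ∧
      (∀ x ω, X t x ω = max (ENNReal.ofReal α * X (t - s) (x - s • τ) ω)
        (ENNReal.ofReal (1 - α) * Z x ω)) ∧
      IndepFun (fun ω x => Z x ω) (fun ω x => X (t - s) x ω) P ∧
      S.HasSpectralLaw P Z := by
  have hα1' : 0 < 1 - α := sub_pos.2 hα1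
  set p : ℕ → Ω → ℝ × I × S.E := fun i ω => (U i ω, B i ω, C i ω) with hpdef
  set w : I → ℝ := (Set.Ioi (t - s)).indicator fun b => (1 - α)⁻¹ * g (t - b) with hwdef
  have hgt : ∀ t : I, Measurable fun b => g (t - b) := fun t => hg.comp (measurable_const_sub t)
  have hht : ∀ t : I, Measurable fun b => (t - b) • τ := fun t => hτ.comp (measurable_const_sub t)
  have hw : Measurable w := ((hgt t).const_mul _).indicator measurableSet_Ioi
  have hw0 : ∀ b, 0 ≤ w b := fun b =>
    Set.indicator_nonneg (fun b _ => mul_nonneg (inv_nonneg.2 hα1'.le) (hg0 _)) b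
  have hw1 : ∫⁻ b, ENNReal.ofReal (w b) ∂δ = 1 := by
    have h1 : ∀ b, ENNReal.ofReal (w b) = (Set.Ioi (t - s)).indicator
        (fun b => ENNReal.ofReal (1 - α)⁻¹ * ENNReal.ofReal (g (t - b))) b := by
      intro b
      by_cases hb : b ∈ Set.Ioi (t - s)
      · simp only [hwdef]
        rw [Set.indicator_of_mem hb, Set.indicator_of_mem hb,
          ENNReal.ofReal_mul (inv_nonneg.2 hα1'.le)]
      · simp only [hwdef]
        rw [Set.indicator_of_notMem hb, Set.indicator_of_notMem hb, ENNReal.ofReal_zero]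
    simp_rw [h1]
    rw [lintegral_indicator measurableSet_Ioi, lintegral_const_mul _ (hgt t).ennreal_ofReal,
      setLIntegral_kernel_Ioi hg hgneg hα0.le hshift hint,
      ← ENNReal.ofReal_mul (inv_nonneg.2 hα1'.le), inv_mul_cancel₀ hα1'.ne', ENNReal.ofReal_one]
  have hXw : ∀ t x ω,
      X t x ω = supField (weighted S (fun b => g (t - b)) fun b => (t - b) • τ) p x ω := hX
  have hm1 := measurable_weighted hS hw (hht t)
  have hm2 := measurable_weighted hS (hgt (t - s)) (hht (t - s))
  refine ⟨supField (weighted S w fun b => (t - b) • τ) p, measurable_supField hm1 hp.measurable,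
    fun x ω => ?_, ?_, hasSpectralLaw_weighted hS hw hw0 hw1 (hht t) hp⟩
  · rw [hXw, hXw]
    simp only [supField]
    rw [ENNReal.mul_iSup, ENNReal.mul_iSup, ← iSup_sup_eq]
    refine iSup_congr fun i => ?_
    rw [← ENNReal.ofReal_mul hα0.le, ← ENNReal.ofReal_mul hα1'.le]
    simp only [weighted, hpdef]
    rcases le_or_gt (B i ω) (t - s) with hb | hb
    · have h1 : w (B i ω) = 0 := Set.indicator_of_notMem (by simpa using hb) _
      have h2 : g (t - B i ω) = α * g (t - s - B i ω) := by
        rw [← hshift _ (sub_nonneg.2 hb)]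
        congr 1
        abel
      have h3 : x - s • τ - (t - s - B i ω) • τ = x - (t - B i ω) • τ := by
        rw [sub_sub, ← add_smul]
        congr 2
        abel
      rw [h1, h2, h3]
      simp only [zero_mul, mul_zero, ENNReal.ofReal_zero]
      rw [max_eq_left zero_le]
      congr 1
      ring
    · have h1 : w (B i ω) = (1 - α)⁻¹ * g (t - B i ω) := Set.indicator_of_mem hb _
      have h2 : g (t - s - B i ω) = 0 := hgneg _ (sub_neg.2 hb)
      rw [h1, h2]
      simp only [zero_mul, mul_zero, ENNReal.ofReal_zero]
      rw [max_eq_right zero_le]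
      congr 1
      field_simp
  · have hind := hp.iIndepFun_supField (K := Bool)
      (ψ := fun k => bif k then weighted S w (fun b => (t - b) • τ)
        else weighted S (fun b => g (t - s - b)) fun b => (t - s - b) • τ)
      (D := fun k => bif k then {q | t - s < q.2.1} else {q | q.2.1 ≤ t - s})
      (by rintro (_ | _) x; exacts [hm2 x, hm1 x]) ?_ ?_
    · have := hind.indepFun (i := true) (j := false) (by simp)
      simp only [cond_true, cond_false] at this
      simpa only [hXw] using this
    · have hd : Disjoint {q : ℝ × I × S.E | t - s < q.2.1} {q | q.2.1 ≤ t - s} :=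
        Set.disjoint_left.2 fun q h1 h2 => not_lt.2 h2 h1
      rintro (_ | _) (_ | _) hij
      exacts [absurd rfl hij, hd.symm, hd, absurd rfl hij]
    · rintro (_ | _) x q hq
      · have h1 : t - s < q.2.1 := by simpa using hq
        simp [weighted, hgneg _ (sub_neg.2 h1)]
      · have h1 : q.2.1 ∉ Set.Ioi (t - s) := by simpa using hq
        simp [weighted, hwdef, Set.indicator_of_notMem h1]

/-! ### The exponential and geometric kernels -/

lemma measurable_expDensity (ν : ℝ) : Measurable (expDensity ν) :=
  Measurable.ite measurableSet_Ici (by fun_prop) measurable_const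

lemma expDensity_nonneg {ν : ℝ} (hν : 0 < ν) (r : ℝ) : 0 ≤ expDensity ν r := by
  unfold expDensity
  split_ifs <;> positivity

lemma expDensity_of_neg {ν r : ℝ} (hr : r < 0) : expDensity ν r = 0 := if_neg (not_le.2 hr)

lemma expDensity_add {ν s : ℝ} (hs : 0 < s) {r : ℝ} (hr : 0 ≤ r) :
    expDensity ν (r + s) = Real.exp (-ν) ^ s * expDensity ν r := by
  rw [expDensity, expDensity, if_pos hr, if_pos (add_nonneg hr hs.le), ← Real.exp_mul, mul_add,
    Real.exp_add]
  ring

lemma lintegral_expDensity {ν : ℝ} (hν : 0 < ν) (t : ℝ) :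
    ∫⁻ b, ENNReal.ofReal (expDensity ν (t - b)) = 1 := by
  rw [lintegral_sub_left_eq_self (fun b => ENNReal.ofReal (expDensity ν b)) t,
    ← lintegral_exponentialPDF_eq_one hν]
  refine lintegral_congr fun b => ?_
  rw [exponentialPDF_eq, expDensity, neg_mul]

lemma geomWeight_nonneg {φ : ℝ} (h0 : 0 < φ) (h1 : φ < 1) (r : ℤ) : 0 ≤ geomWeight φ r := by
  have := sub_pos.2 h1
  unfold geomWeight
  split_ifs <;> positivity

lemma geomWeight_of_neg {φ : ℝ} {r : ℤ} (hr : r < 0) : geomWeight φ r = 0 := if_neg (not_le.2 hr)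

lemma geomWeight_natCast (φ : ℝ) (n : ℕ) : geomWeight φ n = φ ^ n * (1 - φ) := by
  rw [geomWeight, if_pos (Int.natCast_nonneg n), zpow_natCast, mul_comm]

lemma geomWeight_add {φ : ℝ} (h0 : 0 < φ) {s : ℤ} (hs : 0 < s) {r : ℤ} (hr : 0 ≤ r) :
    geomWeight φ (r + s) = φ ^ s * geomWeight φ r := by
  rw [geomWeight, geomWeight, if_pos hr, if_pos (add_nonneg hr hs.le), zpow_add₀ h0.ne']
  ring

lemma lintegral_geomWeight {φ : ℝ} (h0 : 0 < φ) (h1 : φ < 1) (t : ℤ) :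
    ∫⁻ b, ENNReal.ofReal (geomWeight φ (t - b)) ∂(Measure.count : Measure ℤ) = 1 := by
  have h2 : ∑' n : ℕ, ENNReal.ofReal (geomWeight φ n) =
      ∑' k : ℤ, ENNReal.ofReal (geomWeight φ k) := by
    refine Nat.cast_injective.tsum_eq (f := fun k : ℤ => ENNReal.ofReal (geomWeight φ k))
      fun k hk => ?_
    have hk0 : 0 ≤ k := by
      by_contra! h
      simp [geomWeight_of_neg h] at hk
    exact ⟨k.toNat, Int.toNat_of_nonneg hk0⟩
  have h3 := (hasSum_geometric_of_lt_one h0.le h1).mul_right (1 - φ)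
  rw [inv_mul_cancel₀ (sub_pos.2 h1).ne'] at h3
  have h4 : ∑' b : ℤ, ENNReal.ofReal (geomWeight φ (t - b)) =
      ∑' k : ℤ, ENNReal.ofReal (geomWeight φ k) :=
    (Equiv.subLeft t).tsum_eq fun k => ENNReal.ofReal (geomWeight φ k)
  rw [lintegral_count, h4, ← h2,
    ← ENNReal.ofReal_tsum_of_nonneg (f := fun n : ℕ => geomWeight φ n)
      (fun n => geomWeight_nonneg h0 h1 n)]
  · simp_rw [geomWeight_natCast]
    rw [h3.tsum_eq, ENNReal.ofReal_one]
  · simp_rw [geomWeight_natCast]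
    exact h3.summable

/-! ### Max-moving averages -/

section MovingAverage

variable {Ω : Type*} {a : ℝ} {τ : Plane} {Z : ℤ → Plane → Ω → ℝ≥0∞}

lemma maxMovingAverage_recursion (ha0 : 0 ≤ a) (t : ℤ) (x : Plane) (ω : Ω) :
    maxMovingAverage a τ Z t x ω = max (ENNReal.ofReal a * maxMovingAverage a τ Z (t - 1) (x - τ) ω)
      (ENNReal.ofReal (1 - a) * Z t x ω) := by
  rw [maxMovingAverage, ← sup_iSup_nat_succ, max_comm, maxMovingAverage, ENNReal.mul_iSup]
  congr 1
  · refine iSup_congr fun j => ?_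
    rw [← mul_assoc, ← ENNReal.ofReal_mul ha0]
    have h1 : t - ((j + 1 : ℕ) : ℤ) = t - 1 - j := by push_cast; ring
    have h2 : x - (j + 1) • τ = x - τ - j • τ := by rw [add_smul, one_smul]; abel
    rw [h1, h2, pow_succ]
    ring_nf
  · simp

variable [MeasurableSpace Ω] {P : Measure Ω}

lemma measurable_maxMovingAverage (hZ : ∀ t x, Measurable (Z t x)) (t : ℤ) (x : Plane) :
    Measurable (maxMovingAverage a τ Z t x) :=
  Measurable.iSup fun _ => (hZ _ _).const_mul _

lemma indepFun_maxMovingAverage (hZ : ∀ t x, Measurable (Z t x))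
    (hind : iIndepFun (fun t ω x => Z t x ω) P) (t : ℤ) :
    IndepFun (fun ω x => Z t x ω) (fun ω x => maxMovingAverage a τ Z (t - 1) x ω) P := by
  have hm : ∀ k, Measurable fun ω x => Z k x ω := fun k => measurable_pi_lambda _ (hZ k)
  have h1 := indep_iSup_of_disjoint (fun k => (hm k).comap_le) hind
    (S := {t}) (T := Set.Iio t) (by simp)
  refine indep_of_indep_of_le_left (indep_of_indep_of_le_right h1 ?_) ?_
  · rw [← measurable_iff_comap_le]
    refine @measurable_pi_lambda _ _ _ (_) _ _ fun x => ?_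
    refine Measurable.iSup fun j => Measurable.const_mul ?_ _
    have h2 : t - 1 - (j : ℤ) ∈ Set.Iio t := by simp only [Set.mem_Iio]; lia
    exact ((measurable_pi_apply (x - j • τ)).comp
      (comap_measurable fun ω x => Z (t - 1 - j) x ω)).mono
      (le_iSup₂ (f := fun k (_ : k ∈ Set.Iio t) =>
        MeasurableSpace.comap (fun ω x => Z k x ω) MeasurableSpace.pi) _ h2) le_rfl
  · exact le_iSup₂ (f := fun k (_ : k ∈ ({t} : Set ℤ)) =>
      MeasurableSpace.comap (fun ω x => Z k x ω) MeasurableSpace.pi) t rfl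

/-- Iterating the autoregressive equation `n` times leaves the max-moving average and the remainder
`aⁿ Y(t - n, x - nτ)`. Its law is that of `aⁿ Y(t, x)`, so it vanishes in probability. -/
lemma IsMARMASolution.ae_eq_maxMovingAverage (ha0 : 0 < a) (ha1 : a < 1)
    {Y : ℤ → Plane → Ω → ℝ≥0∞} (hY : IsMARMASolution P a τ Z Y) [IsFiniteMeasure P] (t : ℤ)
    (x : Plane) :
    ∀ᵐ ω ∂P, Y t x ω = maxMovingAverage a τ Z t x ω := by
  set α := ENNReal.ofReal a with hα
  let R : ℕ → Ω → ℝ≥0∞ := fun n ω => α ^ n * Y (t - n) (x - n • τ) ω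
  have hrec : ∀ᵐ ω ∂P, ∀ n : ℕ, R n ω = max (R (n + 1) ω)
      (ENNReal.ofReal (a ^ n * (1 - a)) * Z (t - n) (x - n • τ) ω) := by
    refine ae_all_iff.2 fun n => ?_
    filter_upwards [hY.recursion (t - n) (x - n • τ)] with ω hω
    have h1 : t - ((n + 1 : ℕ) : ℤ) = t - n - 1 := by push_cast; ring
    have h2 : x - (n + 1) • τ = x - n • τ - τ := by rw [add_smul, one_smul]; abel
    simp only [R]
    rw [hω, h1, h2, mul_max, ENNReal.ofReal_mul (by positivity), ENNReal.ofReal_pow ha0.le,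
      pow_succ, mul_assoc, mul_assoc]
  have hle : ∀ᵐ ω ∂P, maxMovingAverage a τ Z t x ω ≤ Y t x ω ∧
      ∀ n, Y t x ω ≤ max (R n ω) (maxMovingAverage a τ Z t x ω) := by
    filter_upwards [hrec] with ω hω
    have h0 : R 0 ω = Y t x ω := by simp [R]
    have hanti : Antitone fun n => R n ω := antitone_nat_of_succ_le fun n => by
      rw [hω n]; exact le_max_left _ _
    refine ⟨iSup_le fun n => ?_, fun n => ?_⟩
    · rw [← h0]
      refine le_trans ?_ (hanti n.zero_le)
      change _ ≤ R n ω
      rw [hω n]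
      exact le_max_right _ _
    · induction n with
      | zero => rw [h0]; exact le_max_left _ _
      | succ n ih =>
        refine ih.trans (max_le ?_ (le_max_right _ _))
        rw [hω n]
        exact max_le_max le_rfl
          (le_iSup (fun j : ℕ => ENNReal.ofReal (a ^ j * (1 - a)) * Z (t - j) (x - j • τ) ω) n)
  have htail : Filter.Tendsto (fun N : ℕ => P {ω | (N : ℝ≥0∞) < Y t x ω}) Filter.atTop
      (nhds 0) := by
    have h1 := tendsto_measure_iInter_atTop (μ := P)
      (s := fun N : ℕ => {ω | (N : ℝ≥0∞) < Y t x ω})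
      (fun N => (measurableSet_lt measurable_const (hY.measurable t x)).nullMeasurableSet)
      (fun M N hMN ω (hω : (N : ℝ≥0∞) < Y t x ω) =>
        lt_of_le_of_lt (Nat.cast_le.2 hMN) hω) ⟨0, measure_ne_top _ _⟩
    have h2 : P (⋂ N : ℕ, {ω | (N : ℝ≥0∞) < Y t x ω}) = 0 := by
      refine measure_mono_null (fun ω hω => ?_) (ae_iff.1 (hY.finite t x))
      simp only [Set.mem_iInter, Set.mem_ofPred_eq] at hω
      simpa using ENNReal.eq_top_of_forall_nnreal_le fun r => by
        obtain ⟨N, hN⟩ := exists_nat_ge r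
        exact le_trans (by exact_mod_cast hN) (hω N).le
    rwa [h2] at h1
  have hnull : ∀ k : ℕ, P {ω | (∀ n, (((k + 1 : ℕ) : ℝ≥0∞))⁻¹ < R n ω)} = 0 := by
    intro k
    refine le_antisymm (ge_of_tendsto' htail fun N => ?_) zero_le
    -- `n` is so large that `aⁿ N ≤ 1 / (k + 1)`
    obtain ⟨n, hn⟩ : ∃ n : ℕ, a ^ n * N ≤ ((k + 1 : ℕ) : ℝ)⁻¹ := by
      have h1 : Filter.Tendsto (fun n : ℕ => a ^ n * (N : ℝ)) Filter.atTop (nhds 0) := by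
        simpa using (tendsto_pow_atTop_nhds_zero_of_lt_one ha0.le ha1).mul_const (N : ℝ)
      exact ((h1.eventually (gt_mem_nhds (by positivity))).exists).imp fun n h => h.le
    have hn' : α ^ n * (N : ℝ≥0∞) ≤ (((k + 1 : ℕ) : ℝ≥0∞))⁻¹ := by
      rw [hα, ← ENNReal.ofReal_pow ha0.le, ← ENNReal.ofReal_natCast N,
        ← ENNReal.ofReal_mul (by positivity), ← ENNReal.ofReal_natCast (k + 1),
        ← ENNReal.ofReal_inv_of_pos (by positivity)]
      exact ENNReal.ofReal_le_ofReal hn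
    have h1 := (hY.marginals (t - n) (x - n • τ) t x).measure_mem_eq
      (measurableSet_Ioi (a := (N : ℝ≥0∞)))
    refine le_trans (measure_mono fun ω hω => ?_) h1.le
    have h2 : α ^ n * (N : ℝ≥0∞) < α ^ n * Y (t - n) (x - n • τ) ω := hn'.trans_lt (hω n)
    exact lt_of_mul_lt_mul_left' h2
  filter_upwards [hle, ae_all_iff.2 fun k => measure_eq_zero_iff_ae_notMem.1 (hnull k)]
    with ω hω hω'
  refine le_antisymm ?_ hω.1
  by_contra! hlt
  obtain ⟨k, hk⟩ := ENNReal.exists_inv_nat_lt (ne_bot_of_gt hlt)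
  refine hω' k fun n => lt_of_le_of_lt (ENNReal.inv_le_inv.2 (by simp)) (hk.trans_le ?_)
  exact (le_max_iff.1 (hω.2 n)).resolve_right (not_le.2 hlt)

end MovingAverage

/-! ### Discrete time -/

/-- The spectral functions that keep only the points with time mark `k`. -/
def timeSlice (S : SpatialSpectrum) (k : ℤ) : Plane → ℝ × ℤ × S.E → ℝ :=
  weighted S (fun b => if b = k then 1 else 0) fun _ => 0

/-- In discrete time, grouping the points by their time marks exhibits the space-time process as a
max-moving average. -/
lemma spectralProcess_eq_maxMovingAverage {S : SpatialSpectrum} {τ : Plane} {φ : ℝ} (h0 : 0 < φ)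
    (h1 : φ < 1) {Ω : Type*} {U : ℕ → Ω → ℝ} {B : ℕ → Ω → ℤ} {C : ℕ → Ω → S.E} (t : ℤ)
    (x : Plane) (ω : Ω) :
    spectralProcess (S.spaceTime (geomWeight φ) τ) U (fun i ω => (B i ω, C i ω)) (t, x) ω =
      maxMovingAverage φ τ (fun k => supField (timeSlice S k) fun i ω => (U i ω, B i ω, C i ω))
        t x ω := by
  have h1' := sub_pos.2 h1
  simp only [spectralProcess, maxMovingAverage, supField, ENNReal.mul_iSup]
  rw [iSup_comm]
  refine iSup_congr fun i => ?_
  have hj : ∀ j : ℕ, B i ω ≠ t - j → ENNReal.ofReal (φ ^ j * (1 - φ)) *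
      ENNReal.ofReal (timeSlice S (t - j) (x - j • τ) (U i ω, B i ω, C i ω)) = 0 := by
    intro j hj
    simp [timeSlice, weighted, hj]
  rcases le_or_gt (B i ω) t with hb | hb
  · obtain ⟨n, hn⟩ := Int.eq_ofNat_of_zero_le (sub_nonneg.2 hb)
    have hbn : B i ω = t - n := by lia
    refine le_antisymm (le_iSup_of_le n (le_of_eq ?_)) (iSup_le fun j => ?_)
    · rw [← ENNReal.ofReal_mul (by positivity)]
      congr 1
      simp only [SpatialSpectrum.spaceTime, timeSlice, weighted]
      rw [hn, geomWeight_natCast, if_pos hbn, sub_zero, natCast_zsmul]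
      ring
    · by_cases hjn : j = n
      · subst hjn
        rw [← ENNReal.ofReal_mul (by positivity)]
        refine le_of_eq (congrArg _ ?_)
        simp only [SpatialSpectrum.spaceTime, timeSlice, weighted]
        rw [hn, geomWeight_natCast, if_pos hbn, sub_zero, natCast_zsmul]
        ring
      · rw [hj j (by lia)]
        exact zero_le
  · have hg : geomWeight φ (t - B i ω) = 0 := geomWeight_of_neg (sub_neg.2 hb)
    simp only [SpatialSpectrum.spaceTime, hg]
    simp only [zero_mul, mul_zero, ENNReal.ofReal_zero]
    exact (iSup_eq_bot.2 fun j => hj j (by lia)).symm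

/-- At each time, also after a spatial translation, a discrete space-time process has the spatial
spectral law, since the weights of its kernel sum to one. -/
lemma hasSpectralLaw_discrete {S : SpatialSpectrum} (hS : S.IsRegular) {τ : Plane} {φ : ℝ}
    (h0 : 0 < φ) (h1 : φ < 1) {Ω : Type u} [MeasurableSpace Ω] {P : Measure Ω}
    [IsProbabilityMeasure P] {U : ℕ → Ω → ℝ} {B : ℕ → Ω → ℤ} {C : ℕ → Ω → S.E}
    {X : ℤ → Plane → Ω → ℝ≥0∞}
    (hp : IsPoissonPoints (fun i ω => (U i ω, B i ω, C i ω))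
      (heightMeasure.prod ((Measure.count : Measure ℤ).prod S.μ)) P)
    (hX : ∀ t x ω, X t x ω =
      spectralProcess (S.spaceTime (geomWeight φ) τ) U (fun i ω => (B i ω, C i ω)) (t, x) ω)
    (t : ℤ) (k : Plane) :
    (∀ x, Measurable fun ω => X t (x + k) ω) ∧
      S.HasSpectralLaw P (fun x ω => X t (x + k) ω) := by
  have hw : Measurable fun b : ℤ => geomWeight φ (t - b) := .of_discrete
  have hh : Measurable fun b : ℤ => (t - b) • τ - k := .of_discrete
  have h2 : (fun x ω => X t (x + k) ω) = supField
      (weighted S (fun b => geomWeight φ (t - b)) fun b => (t - b) • τ - k)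
      fun i ω => (U i ω, B i ω, C i ω) := by
    ext x ω
    rw [hX]
    simp only [spectralProcess, supField, weighted, SpatialSpectrum.spaceTime]
    refine iSup_congr fun i => ?_
    rw [show x + k - (t - B i ω) • τ = x - ((t - B i ω) • τ - k) by abel]
  refine ⟨fun x => ?_, ?_⟩
  · have := measurable_supField (measurable_weighted hS hw hh) hp.measurable x
    rwa [← h2] at this
  · rw [h2]
    exact hasSpectralLaw_weighted hS hw (fun b => geomWeight_nonneg h0 h1 _)
      (lintegral_geomWeight h0 h1 t) hh hp

/-- Max-moving averages of iid fields with the spatial spectral law have the finite-dimensional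
distributions of the space-time process: the latter is a max-moving average of its time slices,
which are iid with that law too. -/
lemma identDistrib_maxMovingAverage {S : SpatialSpectrum} (hS : S.IsRegular) {τ : Plane}
    {φ : ℝ} (h0 : 0 < φ) (h1 : φ < 1) {Ω Ω' : Type u} [MeasurableSpace Ω] {P : Measure Ω}
    [IsProbabilityMeasure P] {U : ℕ → Ω → ℝ} {B : ℕ → Ω → ℤ} {C : ℕ → Ω → S.E}
    {X : ℤ → Plane → Ω → ℝ≥0∞}
    (hp : IsPoissonPoints (fun i ω => (U i ω, B i ω, C i ω))
      (heightMeasure.prod ((Measure.count : Measure ℤ).prod S.μ)) P)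
    (hX : ∀ t x ω, X t x ω =
      spectralProcess (S.spaceTime (geomWeight φ) τ) U (fun i ω => (B i ω, C i ω)) (t, x) ω)
    [MeasurableSpace Ω'] {P' : Measure Ω'} [IsProbabilityMeasure P'] {Z : ℤ → Plane → Ω' → ℝ≥0∞}
    (hZ : ∀ t x, Measurable (Z t x)) (hind : iIndepFun (fun t ω x => Z t x ω) P')
    (hlaw : ∀ t, S.HasSpectralLaw P' (Z t)) {M : ℕ} (t : Fin M → ℤ) (x : Fin M → Plane) :
    IdentDistrib (fun ω m => X (t m) (x m) ω)
      (fun ω m => maxMovingAverage φ τ Z (t m) (x m) ω) P P' := by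
  set p : ℕ → Ω → ℝ × ℤ × S.E := fun i ω => (U i ω, B i ω, C i ω)
  have hψ : ∀ k x, Measurable (timeSlice S k x) := fun k x =>
    measurable_weighted hS .of_discrete measurable_const x
  have hζ : ∀ k x, Measurable (supField (timeSlice S k) p x) := fun k =>
    measurable_supField (hψ k) hp.measurable
  have hζlaw : ∀ k, S.HasSpectralLaw P (supField (timeSlice S k) p) := by
    intro k
    refine hasSpectralLaw_weighted hS .of_discrete (fun b => by positivity) ?_ measurable_const hp
    rw [lintegral_count, tsum_eq_single k fun b hb => by simp [hb]]
    simp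
  have hζind : iIndepFun (fun k ω x => supField (timeSlice S k) p x ω) P := by
    refine hp.iIndepFun_supField hψ (D := fun k => {q | q.2.1 = k}) (fun j k hjk => ?_) ?_
    · exact Set.disjoint_left.2 fun q hj hk => hjk (hj.symm.trans hk)
    · intro k x q hq
      have : q.2.1 ≠ k := hq
      simp [timeSlice, weighted, this]
  have hmζ : ∀ k, Measurable fun ω x => supField (timeSlice S k) p x ω := fun k =>
    measurable_pi_lambda _ (hζ k)
  have hmZ : ∀ k, Measurable fun ω x => Z k x ω := fun k => measurable_pi_lambda _ (hZ k)
  have hjoint : IdentDistrib (fun ω k x => supField (timeSlice S k) p x ω)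
      (fun ω k x => Z k x ω) P P' := by
    refine ⟨(measurable_pi_lambda _ hmζ).aemeasurable,
      (measurable_pi_lambda _ hmZ).aemeasurable, ?_⟩
    rw [hζind.map_fun_eq_infinitePi_map hmζ, hind.map_fun_eq_infinitePi_map hmZ]
    congr 1
    ext1 k
    exact (hζlaw k).map_eq hS (hζ k) (hZ k) (hlaw k)
  -- the max-moving average as a function of the whole family of fields
  have hF : Measurable fun (f : ℤ → Plane → ℝ≥0∞) (m : Fin M) =>
      maxMovingAverage φ τ (fun k y f => f k y) (t m) (x m) f :=
    measurable_pi_lambda _ fun m => measurable_maxMovingAverage (fun k y => by fun_prop) _ _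
  have h2 := hjoint.comp hF
  have h3 : (fun ω m => X (t m) (x m) ω) = fun ω m =>
      maxMovingAverage φ τ (fun k => supField (timeSlice S k) p) (t m) (x m) ω := by
    ext ω m
    rw [hX, spectralProcess_eq_maxMovingAverage h0 h1]
  rw [h3]
  exact h2

/-- The max-moving average of iid fields with the spatial spectral law solves the MARMA equation.
Its marginals are those of the space-time process. -/
lemma isMARMASolution_maxMovingAverage {S : SpatialSpectrum} (hS : S.IsRegular) {τ : Plane}
    {φ : ℝ} (h0 : 0 < φ) (h1 : φ < 1) {Ω Ω' : Type u} [MeasurableSpace Ω] {P : Measure Ω}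
    [IsProbabilityMeasure P] {U : ℕ → Ω → ℝ} {B : ℕ → Ω → ℤ} {C : ℕ → Ω → S.E}
    {X : ℤ → Plane → Ω → ℝ≥0∞}
    (hp : IsPoissonPoints (fun i ω => (U i ω, B i ω, C i ω))
      (heightMeasure.prod ((Measure.count : Measure ℤ).prod S.μ)) P)
    (hX : ∀ t x ω, X t x ω =
      spectralProcess (S.spaceTime (geomWeight φ) τ) U (fun i ω => (B i ω, C i ω)) (t, x) ω)
    [MeasurableSpace Ω'] {P' : Measure Ω'} [IsProbabilityMeasure P'] {Z : ℤ → Plane → Ω' → ℝ≥0∞}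
    (hZ : ∀ t x, Measurable (Z t x)) (hind : iIndepFun (fun t ω x => Z t x ω) P')
    (hlaw : ∀ t, S.HasSpectralLaw P' (Z t)) :
    IsMARMASolution P' φ τ Z (maxMovingAverage φ τ Z) := by
  have hXm : ∀ t x, Measurable (X t x) := fun t x => by
    simpa using (hasSpectralLaw_discrete hS h0 h1 hp hX t 0).1 x
  have hXY : ∀ t x, IdentDistrib (X t x) (maxMovingAverage φ τ Z t x) P P' := fun t x =>
    (identDistrib_maxMovingAverage hS h0 h1 hp hX hZ hind hlaw (M := 1) (fun _ => t)
      fun _ => x).comp (u := fun f : Fin 1 → ℝ≥0∞ => f 0) (by fun_prop)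
  have hXX : ∀ t x t' x', IdentDistrib (X t x) (X t' x') P P := by
    intro t x t' x'
    obtain ⟨m1, l1⟩ := hasSpectralLaw_discrete hS h0 h1 hp hX t 0
    obtain ⟨m2, l2⟩ := hasSpectralLaw_discrete hS h0 h1 hp hX t' (x' - x)
    have := IdentDistrib.comp ⟨(measurable_pi_lambda _ m1).aemeasurable,
      (measurable_pi_lambda _ m2).aemeasurable, l1.map_eq hS m1 m2 l2⟩
      (u := fun f : Plane → ℝ≥0∞ => f x) (by fun_prop)
    simpa [Function.comp_def] using this
  refine ⟨measurable_maxMovingAverage hZ,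
    fun t x => ae_of_all _ fun ω => maxMovingAverage_recursion h0.le t x ω, fun t x => ?_,
    fun t x t' x' => (hXY t x).symm.trans ((hXX t x t' x').trans (hXY t' x'))⟩
  obtain ⟨m1, l1⟩ := hasSpectralLaw_discrete hS h0 h1 hp hX t 0
  have h2 := l1.ae_ne_top hS m1 x
  simp only [add_zero] at h2
  exact (hXY t x).ae_snd (p := fun r => r ≠ ∞) (measurableSet_eq_fun measurable_id
    measurable_const).compl h2

end MaxStable

theorem theorem3 (S : MaxStable.SpatialSpectrum) (hS : S.IsType1 ∨ S.IsType4)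
    (τ : MaxStable.Plane) :
    -- (i), continuous time
    (∀ (ν : ℝ), 0 < ν →
      ∀ {Ω : Type u} [MeasurableSpace Ω] (P : Measure Ω) [IsProbabilityMeasure P]
        (U B : ℕ → Ω → ℝ) (C : ℕ → Ω → S.E),
      MaxStable.IsPoissonPoints (fun i ω => (U i ω, B i ω, C i ω))
        (MaxStable.heightMeasure.prod ((volume : Measure ℝ).prod S.μ)) P →
      ∀ X : ℝ → MaxStable.Plane → Ω → ℝ≥0∞,
      (∀ t x ω, X t x ω = MaxStable.spectralProcess (S.spaceTime (MaxStable.expDensity ν) τ)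
        U (fun i ω => (B i ω, C i ω)) (t, x) ω) →
      ∀ t s : ℝ, 0 < s → ∃ Z : MaxStable.Plane → Ω → ℝ≥0∞,
        (∀ x, Measurable (Z x)) ∧
        (∀ x ω, X t x ω = max (ENNReal.ofReal (Real.exp (-ν) ^ s) * X (t - s) (x - s • τ) ω)
          (ENNReal.ofReal (1 - Real.exp (-ν) ^ s) * Z x ω)) ∧
        IndepFun (fun ω x => Z x ω) (fun ω x => X (t - s) x ω) P ∧
        S.HasSpectralLaw P Z) ∧
    -- discrete time
    (∀ (φ : ℝ), 0 < φ → φ < 1 →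
      ∀ {Ω : Type u} [MeasurableSpace Ω] (P : Measure Ω) [IsProbabilityMeasure P]
        (U : ℕ → Ω → ℝ) (B : ℕ → Ω → ℤ) (C : ℕ → Ω → S.E),
      MaxStable.IsPoissonPoints (fun i ω => (U i ω, B i ω, C i ω))
        (MaxStable.heightMeasure.prod ((Measure.count : Measure ℤ).prod S.μ)) P →
      ∀ X : ℤ → MaxStable.Plane → Ω → ℝ≥0∞,
      (∀ t x ω, X t x ω = MaxStable.spectralProcess (S.spaceTime (MaxStable.geomWeight φ) τ)
        U (fun i ω => (B i ω, C i ω)) (t, x) ω) →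
      -- (i)
      (∀ t s : ℤ, 0 < s → ∃ Z : MaxStable.Plane → Ω → ℝ≥0∞,
        (∀ x, Measurable (Z x)) ∧
        (∀ x ω, X t x ω = max (ENNReal.ofReal (φ ^ s) * X (t - s) (x - s • τ) ω)
          (ENNReal.ofReal (1 - φ ^ s) * Z x ω)) ∧
        IndepFun (fun ω x => Z x ω) (fun ω x => X (t - s) x ω) P ∧
        S.HasSpectralLaw P Z) ∧
      -- (ii)
      (∀ {Ω' : Type u} [MeasurableSpace Ω'] (P' : Measure Ω') [IsProbabilityMeasure P']
        (Z : ℤ → MaxStable.Plane → Ω' → ℝ≥0∞),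
        (∀ t x, Measurable (Z t x)) →
        iIndepFun (fun t ω x => Z t x ω) P' →
        (∀ t, S.HasSpectralLaw P' (Z t)) →
        -- equality in law with the max-moving average
        (∀ (M : ℕ) (t : Fin M → ℤ) (x : Fin M → MaxStable.Plane),
          IdentDistrib (fun ω m => X (t m) (x m) ω)
            (fun ω m => MaxStable.maxMovingAverage φ τ Z (t m) (x m) ω) P P') ∧
        -- which is the unique solution of the spatial MARMA(1,0) equation
        MaxStable.IsMARMASolution P' φ τ Z (MaxStable.maxMovingAverage φ τ Z) ∧
        (∀ t, IndepFun (fun ω x => Z t x ω)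
          (fun ω x => MaxStable.maxMovingAverage φ τ Z (t - 1) x ω) P') ∧
        (∀ Y : ℤ → MaxStable.Plane → Ω' → ℝ≥0∞, MaxStable.IsMARMASolution P' φ τ Z Y →
          ∀ t x, ∀ᵐ ω ∂P', Y t x ω = MaxStable.maxMovingAverage φ τ Z t x ω))) := by
  have hR : S.IsRegular := hS.elim (fun h => h.isRegular) fun h => h.isRegular
  refine ⟨?_, ?_⟩
  · intro ν hν Ω _ P _ U B C hp X hX t s hs
    refine MaxStable.exists_innovation hR (by fun_prop) (MaxStable.measurable_expDensity ν)
      (MaxStable.expDensity_nonneg hν) (fun r => MaxStable.expDensity_of_neg)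
      (by positivity) ?_ (fun r => MaxStable.expDensity_add hs)
      (MaxStable.lintegral_expDensity hν) hp hX
    exact Real.rpow_lt_one (Real.exp_pos _).le (Real.exp_lt_one_iff.2 (neg_lt_zero.2 hν)) hs
  · intro φ h0 h1 Ω _ P _ U B C hp X hX
    refine ⟨fun t s hs => ?_, ?_⟩
    · exact MaxStable.exists_innovation hR .of_discrete .of_discrete
        (MaxStable.geomWeight_nonneg h0 h1) (fun r => MaxStable.geomWeight_of_neg)
        (by positivity) (zpow_lt_one₀ h0 h1 hs) (fun r => MaxStable.geomWeight_add h0 hs)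
        (MaxStable.lintegral_geomWeight h0 h1) hp hX
    · intro Ω' _ P' _ Z hZ hind hlaw
      exact ⟨fun M t x =>
          MaxStable.identDistrib_maxMovingAverage hR h0 h1 hp hX hZ hind hlaw t x,
        MaxStable.isMARMASolution_maxMovingAverage hR h0 h1 hp hX hZ hind hlaw,
        MaxStable.indepFun_maxMovingAverage hZ hind,
        fun Y hY t x => hY.ae_eq_maxMovingAverage h0 h1 t x⟩
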